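/- Let $d\ge 1$. A (generalized) measurement on a $d$-level quantum system is a family of positive semidefinite operators $\Pi_\xi$ on $\mathbb C^d$, indexed by a measure space of outcomes, with $\int\Pi_\xi\,\mathrm d\xi=1$ (a sum $\sum_\xi\Pi_\xi=1$ in the discrete case). It is performed on each copy of the system, whatever the earlier outcomes (nonadaptive). For a state $\rho$ the outcome probabilities are $p_\xi=\operatorname{tr}(\Pi_\xi\rho)$; the measurement is informationally complete (IC) if the probabilities $p_\xi$ (for almost every $\xi$) determine the state. The covariant measurement has as outcomes all pure states $|\psi\rangle\langle\psi|$, with outcome operators $d\,|\psi\rangle\langle\psi|\,\mathrm d\mu(\psi)$, where $\mu$ is the normalized Haar (unitarily invariant) measure on pure states. Write $|A\rangle\!\rangle$ for an operator $A$ regarded as a vector in the Hilbert-Schmidt space, $\langle\!\langle A|B\rangle\!\rangle=\operatorname{tr}(A^\dagger B)$, and $\operatorname{Tr}$ for the trace of superoperators. For a full-rank state $\rho$ and an IC measurement let $$\mathcal F(\rho)=\int |\Pi_\xi\rangle\!\rangle\frac1{p_\xi}\langle\!\langle\Pi_\xi|\,\mathrm d\xi,\qquad |\Theta_\xi\rangle\!\rangle=p_\xi^{-1}\mathcal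 F(\rho)^{-1}|\Pi_\xi\rangle\!\rangle,\qquad \mathcal C(\rho)=\int|\Theta_\xi\rangle\!\rangle p_\xi\langle\!\langle\Theta_\xi|\,\mathrm d\xi-|\rho\rangle\!\rangle\langle\!\langle\rho|$$ be the frame superoperator, the optimal reconstruction operators, and the scaled mean-square error matrix of the corresponding estimator. For a distance $D$ on states whose square has, at every full-rank state $\rho$, the expansion $D(\rho,\sigma)^2=\langle\!\langle\sigma-\rho|\mathcal W(\rho)|\sigma-\rho\rangle\!\rangle+o(\|\sigma-\rho\|_{\mathrm{HS}}^2)$ as $\sigma\to\rho$ in the set of states, with a positive semidefinite weighting matrix $\mathcal W(\rho)$, the scaled weighted mean-square error (WMSE) based on $D$ is $\mathcal E_{\mathcal W}(\rho)=\operatorname{Tr}\{\mathcal W(\rho)\,\mathcal C(\rho)\}$. The volume of the scaled uncertainty ellipsoid is $$\mathcal V(\rho)=\frac{\pi^{(d^2-1)/2}}{\Gamma\bigl(\frac{d^2+1}2\bigr)}\sqrt{\bar{\operatorname{Det}}\,\mathcal C(\rho)},$$ where $\bar{\operatorname{Det}}$ is the determinant of the restriction to the space of traceless Hermitian operators. The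 average of a figure of merit $f$ over the states unitarily equivalent to $\rho$ is $\overline{f(\rho)}=\int f(V\rho V^\dagger)\,\mathrm dV$, with respect to the normalized Haar measure on $U(d)$. **Theorem.** The covariant measurement is IC. For every full-rank state $\rho$ and every IC measurement, the following averages exist for both measurements, and their values for the covariant measurement are at most those for the given measurement: 1. the average WMSE $\overline{\mathcal E_{\mathcal W}(\rho)}$ based on any unitarily invariant distance $D$ (that is, $D(V\rho V^\dagger,V\sigma V^\dagger)=D(\rho,\sigma)$ for all unitary $V$) with weighting matrix $\mathcal W$ as above; 2. in particular, the average mean-square error (MSE): the Hilbert-Schmidt distance is unitarily invariant and has the weighting matrix $\mathcal W=\mathbf I$; 3. in particular, the average mean-square Bures distance (MSB): the Bures distance $D_{\mathrm B}(\rho,\sigma)^2=2-2\operatorname{tr}\sqrt{\sqrt\rho\,\sigma\sqrt\rho}$ is unitarily invariant and its weighting matrix $\mathcal W_{\mathrm B}(\rho)$ is half the inverse of the superoperator $X\mapsto\rho X+X\rho$, that is, $\langle\!\langle X|\mathcal W_{\mathrm B}(\rho)|X\rangle\!\rangle=\frac12\sum_{j,k}\frac{|\langle j|X|k\rangle|^2}{\lambda_j+\lambda_k}$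 for Hermitian $X$, in an eigenbasis $|j\rangle$ of $\rho$ with eigenvalues $\lambda_j$; 4. the average log-volume $\overline{\ln\mathcal V(\rho)}$ of the scaled uncertainty ellipsoid. -/

import Mathlib

open Matrix MeasureTheory Topology
open scoped Kronecker ComplexOrder

noncomputable section

namespace QTomo

/-- Operators on the `d`-dimensional Hilbert space. -/
abbrev Op (d : ℕ) := Matrix (Fin d) (Fin d) ℂ

/-- Superoperators, written as matrices that act on the operator kets `|A⟩⟩ = A.vec`. -/
abbrev SuperOp (d : ℕ) := Matrix (Fin d × Fin d) (Fin d × Fin d) ℂ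

/-- The unitary group `U(d)`. -/
abbrev U (d : ℕ) := Matrix.unitaryGroup (Fin d) ℂ

/-- The superoperator `|A⟩⟩⟨⟨B|`. -/
def ketBra {d : ℕ} (A B : Op d) : SuperOp d := vecMulVec A.vec (star B.vec)

/-- The number `⟨⟨X|O|X⟩⟩` (its real part, which is all of it for Hermitian `O`). -/
def quadForm {d : ℕ} (O : SuperOp d) (X : Op d) : ℝ := (star X.vec ⬝ᵥ (O *ᵥ X.vec)).re

/-- The unitarily transformed operator `V A V†`. -/
def conj {d : ℕ} (V : U d) (A : Op d) : Op d := (V : Op d) * A * (V : Op d)ᴴ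

/-! ### Quantum states -/

/-- Density operators. -/
def IsState {d : ℕ} (ρ : Op d) : Prop := ρ.PosSemidef ∧ ρ.trace = 1

/-- Density operators of full rank. -/
def IsFullRankState {d : ℕ} (ρ : Op d) : Prop := ρ.PosDef ∧ ρ.trace = 1

/-! ### Measurements and their statistics -/

/-- A generalized measurement with outcomes `ξ ∈ Ω`: the operators `Π_ξ ≥ 0` together with a
reference measure `dξ`, with `∫ Π_ξ dξ = 1` (entrywise). For the counting measure on a finite or
countable `Ω` this is a family of positive operators that sum up to the identity. -/
structure Measurement (d : ℕ) (Ω : Type*) [MeasurableSpace Ω] where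
  ref : Measure Ω
  op : Ω → Op d
  posSemidef : ∀ ξ, (op ξ).PosSemidef
  integrable : ∀ i j, Integrable (fun ξ => op ξ i j) ref
  integral_eq : ∀ i j, ∫ ξ, op ξ i j ∂ref = (1 : Op d) i j

namespace Measurement

variable {d : ℕ} {Ω : Type*} [MeasurableSpace Ω] (M : Measurement d Ω)

/-- Born rule `p_ξ = tr(Π_ξ ρ)` (a density with respect to the reference measure). -/
def prob (ρ : Op d) (ξ : Ω) : ℝ := (M.op ξ * ρ).trace.re

/-- Informational completeness: every state is determined by the measurement statistics. -/
def IsIC : Prop :=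
  ∀ ρ σ : Op d, IsState ρ → IsState σ → (∀ᵐ ξ ∂M.ref, M.prob ρ ξ = M.prob σ ξ) → ρ = σ

/-- The frame superoperator `F(ρ) = ∫ |Π_ξ⟩⟩ (1 / p_ξ) ⟨⟨Π_ξ| dξ`. -/
def frame (ρ : Op d) : SuperOp d :=
  Matrix.of fun i j => ∫ ξ, ((M.prob ρ ξ)⁻¹ : ℂ) * ketBra (M.op ξ) (M.op ξ) i j ∂M.ref

/-- The optimal reconstruction operators `|Θ_ξ⟩⟩ = p_ξ⁻¹ F(ρ)⁻¹ |Π_ξ⟩⟩`. -/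
def optRec (ρ : Op d) (ξ : Ω) : Op d :=
  Matrix.of fun i j => ((M.prob ρ ξ)⁻¹ : ℂ) * ((M.frame ρ)⁻¹ *ᵥ (M.op ξ).vec) (j, i)

/-- The scaled MSE matrix `∫ |Θ_ξ⟩⟩ p_ξ ⟨⟨Θ_ξ| dξ - |ρ⟩⟩⟨⟨ρ|` of the linear estimator with
reconstruction operators `Θ_ξ`. -/
def mseMatrix (Θ : Ω → Op d) (ρ : Op d) : SuperOp d :=
  (Matrix.of fun i j => ∫ ξ, (M.prob ρ ξ : ℂ) * ketBra (Θ ξ) (Θ ξ) i j ∂M.ref) - ketBra ρ ρ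

/-- The scaled MSE matrix `C(ρ)` under the optimal reconstruction. -/
def optMSEMatrix (ρ : Op d) : SuperOp d := M.mseMatrix (M.optRec ρ) ρ

/-- The scaled weighted mean-square error `Tr{W(ρ) C(ρ)}` under the optimal reconstruction, for a
weighting matrix `W(ρ)`. -/
def wmse (W : Op d → SuperOp d) (ρ : Op d) : ℝ := (W ρ * M.optMSEMatrix ρ).trace.re

end Measurement

/-! ### Volume of the uncertainty ellipsoid -/

/-- The kets `|A⟩⟩` of the traceless operators `A`. This is the complexification of the space of
traceless Hermitian operators. -/
def tracelessKets (d : ℕ) : Submodule ℂ (Fin d × Fin d → ℂ) :=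
  LinearMap.ker (∑ i : Fin d, LinearMap.proj (R := ℂ) (φ := fun _ : Fin d × Fin d => ℂ) (i, i))

theorem mem_tracelessKets {d : ℕ} (v : Fin d × Fin d → ℂ) :
    v ∈ tracelessKets d ↔ ∑ i : Fin d, v (i, i) = 0 := by
  simp [tracelessKets]

/-- The orthogonal projection `A ↦ A - tr(A) / d` onto the traceless operators, on kets. -/
def tracelessProj (d : ℕ) : (Fin d × Fin d → ℂ) →ₗ[ℂ] tracelessKets d :=
  LinearMap.codRestrict (tracelessKets d)
    (LinearMap.id - ((d : ℂ)⁻¹ •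
      ((∑ i : Fin d, LinearMap.proj (R := ℂ) (φ := fun _ : Fin d × Fin d => ℂ) (i, i)).smulRight
        (1 : Op d).vec)))
    (by
      intro v
      rw [mem_tracelessKets]
      rcases Nat.eq_zero_or_pos d with h | h
      · subst h; simp
      · have : (d : ℂ) ≠ 0 := by exact_mod_cast h.ne'
        simp [Finset.sum_sub_distrib]
        field_simp
        simp)

/-- The determinant of the restriction of a superoperator to the space of traceless operators. -/
def barDet {d : ℕ} (O : SuperOp d) : ℂ :=
  LinearMap.det (tracelessProj d ∘ₗ O.mulVecLin ∘ₗ (tracelessKets d).subtype)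

/-- The volume of the unit ball of dimension `d² - 1`. -/
def unitBallVol (d : ℕ) : ℝ :=
  Real.pi ^ (((d : ℝ) ^ 2 - 1) / 2) / Real.Gamma (((d : ℝ) ^ 2 + 1) / 2)

/-- The volume of the scaled uncertainty ellipsoid under the optimal reconstruction. -/
def Measurement.volume {d : ℕ} {Ω : Type*} [MeasurableSpace Ω] (M : Measurement d Ω)
    (ρ : Op d) : ℝ :=
  unitBallVol d * Real.sqrt (barDet (M.optMSEMatrix ρ)).re

/-! ### Haar measure and averages over unitarily equivalent states -/

instance (d : ℕ) : MeasurableSpace (U d) := borel _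

instance (d : ℕ) : BorelSpace (U d) := ⟨rfl⟩

instance (d : ℕ) : CompactSpace (U d) := by
  suffices h : IsCompact ((U d : Submonoid (Op d)) : Set (Op d)) from
    isCompact_iff_compactSpace.mp h
  have hK : IsCompact (Set.pi Set.univ fun _ : Fin d =>
      Set.pi Set.univ fun _ : Fin d => Metric.closedBall (0 : ℂ) 1) :=
    isCompact_univ_pi fun _ => isCompact_univ_pi fun _ => isCompact_closedBall 0 1
  refine hK.of_isClosed_subset ?_ ?_
  · have : ((U d : Submonoid (Op d)) : Set (Op d)) =
        {A : Op d | A * star A = 1} := by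
      ext A
      exact Matrix.mem_unitaryGroup_iff
    rw [this]
    have hc : Continuous fun A : Op d => A * Aᴴ :=
      continuous_id.matrix_mul continuous_id.matrix_conjTranspose
    exact isClosed_eq hc continuous_const
  · intro A hA i _ j _
    simpa using entry_norm_bound_of_unitary hA i j

/-- The normalized Haar measure on the unitary group. -/
def haarU (d : ℕ) : Measure (U d) := Measure.haarMeasure ⊤

instance (d : ℕ) : (haarU d).IsHaarMeasure := by unfold haarU; infer_instance

instance (d : ℕ) : IsProbabilityMeasure (haarU d) :=
  ⟨by simpa [haarU] using Measure.haarMeasure_self (K₀ := (⊤ : TopologicalSpace.PositiveCompacts (U d)))⟩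

/-- The average of a figure of merit over the states `V ρ V†`, with `V` Haar distributed. -/
def orbitAverage {d : ℕ} (f : Op d → ℝ) (ρ : Op d) : ℝ := ∫ V : U d, f (conj V ρ) ∂haarU d

/-- Both figures of merit have an average over the states unitarily equivalent to `ρ`, and the
average of the first is at most that of the second. -/
def OrbitAverageLE {d : ℕ} (f g : Op d → ℝ) (ρ : Op d) : Prop :=
  Integrable (fun V : U d => f (conj V ρ)) (haarU d) ∧
  Integrable (fun V : U d => g (conj V ρ)) (haarU d) ∧
  orbitAverage f ρ ≤ orbitAverage g ρ

/-! ### The covariant measurement -/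

/-- Pure states, that is, rank-one orthogonal projectors `|ψ⟩⟨ψ|`. -/
def PureState (d : ℕ) : Type := {P : Op d // P.IsHermitian ∧ P * P = P ∧ P.trace = 1}

instance (d : ℕ) : TopologicalSpace (PureState d) := instTopologicalSpaceSubtype

instance (d : ℕ) : MeasurableSpace (PureState d) := borel _

instance (d : ℕ) : BorelSpace (PureState d) := ⟨rfl⟩

theorem star_mul_coe {d : ℕ} (V : U d) : (V : Op d)ᴴ * (V : Op d) = 1 :=
  Matrix.mem_unitaryGroup_iff'.mp V.2

/-- The pure state `V |0⟩⟨0| V†`. -/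
def pureOrbit (d : ℕ) [NeZero d] (V : U d) : PureState d :=
  ⟨conj V (Matrix.single 0 0 1), by
    refine ⟨?_, ?_, ?_⟩
    · exact isHermitian_mul_mul_conjTranspose _ (by simp [Matrix.IsHermitian])
    · have h := star_mul_coe V
      calc (V : Op d) * single 0 0 1 * (V : Op d)ᴴ * ((V : Op d) * single 0 0 1 * (V : Op d)ᴴ)
          = (V : Op d) * single 0 0 1 * ((V : Op d)ᴴ * (V : Op d)) * single 0 0 1 * (V : Op d)ᴴ := by
            simp only [Matrix.mul_assoc]
        _ = _ := by rw [h]; simp [Matrix.mul_assoc, conj]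
    · rw [conj, Matrix.trace_mul_comm, ← Matrix.mul_assoc, star_mul_coe]
      simp⟩

/-- The unitarily invariant ("Haar") probability measure on the pure states. -/
def haarPure (d : ℕ) [NeZero d] : Measure (PureState d) := (haarU d).map (pureOrbit d)

theorem continuous_conj {d : ℕ} (A : Op d) : Continuous fun V : U d => conj V A := by
  unfold conj
  have h : Continuous fun V : U d => (V : Op d) := continuous_subtype_val
  exact (h.matrix_mul continuous_const).matrix_mul h.matrix_conjTranspose

theorem continuous_pureOrbit (d : ℕ) [NeZero d] : Continuous (pureOrbit d) :=
  Continuous.subtype_mk (continuous_conj _) _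

theorem continuous_pure_entry {d : ℕ} (i j : Fin d) :
    Continuous fun P : PureState d => P.1 i j :=
  (continuous_subtype_val (p := fun P : Op d =>
    P.IsHermitian ∧ P * P = P ∧ P.trace = 1)).matrix_elem i j

theorem integrable_conj_entry {d : ℕ} (A : Op d) (i j : Fin d) :
    Integrable (fun V : U d => conj V A i j) (haarU d) :=
  ((continuous_conj A).matrix_elem i j).integrable_of_hasCompactSupport
    (HasCompactSupport.of_compactSpace _)

theorem conj_mul {d : ℕ} (V V' : U d) (A : Op d) : conj (V * V') A = conj V (conj V' A) := by
  simp [conj, Matrix.mul_assoc, Matrix.conjTranspose_mul]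

/-- Schur's lemma for the Haar average of an operator. -/
theorem integral_conj {d : ℕ} [NeZero d] (A : Op d) (hA : A.trace = 1) (i j : Fin d) :
    (d : ℂ) * ∫ V : U d, conj V A i j ∂haarU d = (1 : Op d) i j := by
  set B : Op d := Matrix.of fun i j => ∫ V : U d, conj V A i j ∂haarU d with hB
  have inv : ∀ V : U d, conj V B = B := by
    intro V
    ext k l
    have h1 : ∫ V' : U d, conj (V * V') A k l ∂haarU d = B k l :=
      integral_mul_left_eq_self (fun V' : U d => conj V' A k l) V
    rw [← h1]
    simp only [conj_mul]
    simp only [conj, Matrix.mul_apply, Finset.sum_mul]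
    rw [integral_finsetSum _ fun b _ => ?_]
    · refine Finset.sum_congr rfl fun b _ => ?_
      rw [integral_finsetSum _ fun c _ => ?_]
      · refine Finset.sum_congr rfl fun c _ => ?_
        rw [integral_mul_const, integral_const_mul, hB]
        simp [conj, Matrix.mul_apply, Finset.sum_mul]
      · have := ((integrable_conj_entry A c b).const_mul ((V : Op d) k c)).mul_const
          ((V : Op d)ᴴ b l)
        simpa [conj, Matrix.mul_apply, Finset.sum_mul] using this
    · refine integrable_finsetSum _ fun c _ => ?_
      have := ((integrable_conj_entry A c b).const_mul ((V : Op d) k c)).mul_const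
        ((V : Op d)ᴴ b l)
      simpa [conj, Matrix.mul_apply, Finset.sum_mul] using this
  have comm : ∀ V : U d, (V : Op d) * B = B * (V : Op d) := by
    intro V
    have h := congrArg (· * (V : Op d)) (inv V)
    simp only [conj, Matrix.mul_assoc] at h
    rw [star_mul_coe, Matrix.mul_one] at h
    exact h
  have off : ∀ k l, k ≠ l → B k l = 0 := by
    intro k l hkl
    let D : Op d := Matrix.diagonal fun m => if m = k then -1 else 1
    have hD : D ∈ U d := by
      rw [Matrix.mem_unitaryGroup_iff, Matrix.star_eq_conjTranspose]
      simp only [D, Matrix.diagonal_conjTranspose, Matrix.diagonal_mul_diagonal]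
      rw [← Matrix.diagonal_one]
      congr 1
      ext m
      by_cases h : m = k <;> simp [h]
    have h := congrFun (congrFun (comm ⟨D, hD⟩) k) l
    simp only [D, Matrix.diagonal_mul, Matrix.mul_diagonal] at h
    simp only [if_true, if_neg hkl.symm] at h
    have : (2 : ℂ) * B k l = 0 := by linear_combination -h
    simpa using this
  have diag : ∀ k l, B k k = B l l := by
    intro k l
    let P : Op d := (Equiv.swap k l).permMatrix ℂ
    have hP : P ∈ U d := by
      rw [Matrix.mem_unitaryGroup_iff, Matrix.star_eq_conjTranspose]
      simp only [P, Matrix.conjTranspose_permMatrix, ← Matrix.permMatrix_mul]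
      simp
    have h := congrFun (congrFun (comm ⟨P, hP⟩) k) l
    simp only [P] at h
    simpa [Equiv.Perm.permMatrix, PEquiv.toMatrix_toPEquiv_mul, PEquiv.mul_toMatrix_toPEquiv]
      using h.symm
  have tr : ∑ k, B k k = 1 := by
    simp only [hB, Matrix.of_apply]
    rw [← integral_finsetSum _ fun k _ => integrable_conj_entry A k k]
    have : ∀ V : U d, ∑ k, conj V A k k = 1 := by
      intro V
      change (conj V A).trace = 1
      rw [conj, Matrix.trace_mul_comm, ← Matrix.mul_assoc, star_mul_coe, Matrix.one_mul, hA]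
    simp [this]
  change (d : ℂ) * B i j = _
  by_cases hij : i = j
  · subst hij
    rw [Finset.sum_congr rfl fun k _ => diag k i] at tr
    simpa using tr
  · simp [off i j hij, hij]

theorem PureState.posSemidef {d : ℕ} (P : PureState d) : P.1.PosSemidef := by
  have h : P.1 = P.1ᴴ * P.1 := by rw [P.2.1.eq, P.2.2.1]
  rw [h]
  exact Matrix.posSemidef_conjTranspose_mul_self _

/-- The covariant measurement: the outcomes are all pure states, weighted by the Haar measure;
the outcome operators are `d |ψ⟩⟨ψ| dμ(ψ)`. -/
def covariant (d : ℕ) [NeZero d] : Measurement d (PureState d) where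
  ref := haarPure d
  op P := (d : ℂ) • P.1
  posSemidef P := P.posSemidef.smul (by positivity)
  integrable i j := by
    have hm := (continuous_pureOrbit d).measurable.aemeasurable (μ := haarU d)
    refine (integrable_map_measure ?_ hm).mpr ?_
    · exact ((continuous_const (y := (d : ℂ))).mul
        (continuous_pure_entry i j)).aestronglyMeasurable
    · exact (integrable_conj_entry (Matrix.single 0 0 1) i j).const_mul (d : ℂ)
  integral_eq i j := by
    have hm := (continuous_pureOrbit d).measurable.aemeasurable (μ := haarU d)
    rw [haarPure, integral_map hm]
    · have := integral_conj (Matrix.single 0 0 1 : Op d) (by simp) i j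
      rw [← this, ← integral_const_mul]
      rfl
    · exact ((continuous_const (y := (d : ℂ))).mul
        (continuous_pure_entry i j)).aestronglyMeasurable

/-! ### Distances and their weighting matrices -/

/-- Unitary invariance of a function of two states. -/
def UnitarilyInvariant {d : ℕ} (D : Op d → Op d → ℝ) : Prop :=
  ∀ (V : U d) (ρ σ : Op d), IsState ρ → IsState σ → D (conj V ρ) (conj V σ) = D ρ σ

/-- `W` is the weighting matrix of the squared distance `D²`: for every full-rank state `ρ`, the
superoperator `W(ρ)` is positive semidefinite and
`D(ρ, σ)² = ⟨⟨σ - ρ| W(ρ) |σ - ρ⟩⟩ + o(tr (σ - ρ)²)` as the state `σ` tends to `ρ`. -/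
def IsWeightOf {d : ℕ} (W : Op d → SuperOp d) (D : Op d → Op d → ℝ) : Prop :=
  ∀ ρ : Op d, IsFullRankState ρ →
    (W ρ).PosSemidef ∧
    (fun σ : Op d => D ρ σ ^ 2 - quadForm (W ρ) (σ - ρ))
      =o[𝓝[{σ | IsState σ}] ρ] (fun σ : Op d => ((σ - ρ)ᴴ * (σ - ρ)).trace.re)

/-- The Hilbert-Schmidt distance. -/
def hsDist {d : ℕ} (ρ σ : Op d) : ℝ := Real.sqrt (((ρ - σ)ᴴ * (ρ - σ)).trace.re)

/-- The positive square root of a positive semidefinite operator. -/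
def opSqrt {d : ℕ} (A : Op d) : Op d := cfc Real.sqrt A

/-- The Bures distance, `D_B(ρ, σ)² = 2 - 2 tr √(√ρ σ √ρ)`. -/
def buresDist {d : ℕ} (ρ σ : Op d) : ℝ :=
  Real.sqrt (2 - 2 * (opSqrt (opSqrt ρ * σ * opSqrt ρ)).trace.re)

/-- The weighting matrix of the Hilbert-Schmidt distance is the identity; its WMSE is the MSE. -/
def hsWeight {d : ℕ} (_ρ : Op d) : SuperOp d := 1

/-- The weighting matrix of the Bures distance: half the inverse of the superoperator
`X ↦ ρ X + X ρ`, so that `⟨⟨X|W|X⟩⟩ = (1/2) ∑_{jk} |⟨j|X|k⟩|² / (λ_j + λ_k)` in an eigenbasis of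
`ρ`. Its WMSE is the MSB. -/
def buresWeight {d : ℕ} (ρ : Op d) : SuperOp d :=
  (1 / 2 : ℂ) • ((1 : Op d) ⊗ₖ ρ + ρᵀ ⊗ₖ (1 : Op d))⁻¹

end QTomo

end

/-!
The optimal reconstruction operators satisfy `p Θ = F⁻¹ Π`, whence `C(ρ) = F(ρ)⁻¹ - |ρ⟩⟩⟨⟨ρ|` and
`barDet C(ρ) = d / det F(ρ)`: both figures of merit depend on the measurement through the frame
superoperator only. A unitarily invariant distance has a covariant weighting matrix, so in the
average over the orbit of `ρ` one may transport everything back to `ρ`, replacing `F(V ρ V†)` by its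
twirl under `V`. The functions `F ↦ tr (W F⁻¹)` and `F ↦ -log det F` are convex and decreasing, so
by Jensen's inequality it suffices to show that the twirled frame superoperator, averaged over the
unitary group, is at most that of the covariant measurement, which is its own twirl.

As a quadratic form in `X`, `F(ρ)` is the integral of the Fisher information
`|tr (Π X)|² / tr (Π ρ)`, which is subadditive and homogeneous in the outcome operator `Π`.
Splitting `Π` into its spectral projectors, all of which are unitary images of `|0⟩⟨0|`, bounds its
twirled Fisher information by `tr Π` times that of a pure state, and `∫ tr Π = d` is the
normalization of the covariant measurement.

The Bures weight comes from linearizing the matrix square root: if `S² = R² + E` and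
`R L + L R = E`, then `S = R + L + O(‖E‖²)`.
-/

noncomputable section

namespace QTomo

/-! ### Matrix inequalities -/

section PosSemidef

variable {n 𝕜 : Type*} [Fintype n] [RCLike 𝕜] {A B G : Matrix n n 𝕜}

open scoped MatrixOrder in
theorem exists_eq_conjTranspose_mul_self (hA : A.PosSemidef) :
    ∃ B : Matrix n n 𝕜, A = Bᴴ * B := by
  classical exact CStarAlgebra.nonneg_iff_eq_star_mul_self.mp hA.nonneg

theorem trace_mul_nonneg (hA : A.PosSemidef) (hB : B.PosSemidef) : 0 ≤ (A * B).trace := by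
  obtain ⟨C, rfl⟩ := exists_eq_conjTranspose_mul_self hA
  rw [Matrix.mul_assoc, trace_mul_comm]
  exact (hB.mul_mul_conjTranspose_same C).trace_nonneg

theorem eq_of_forall_star_dotProduct_mulVec_eq (hA : A.IsHermitian) (hB : B.IsHermitian)
    (h : ∀ x, star x ⬝ᵥ (A *ᵥ x) = star x ⬝ᵥ (B *ᵥ x)) : A = B := by
  have form_eq_zero : ∀ x, star x ⬝ᵥ ((A - B) *ᵥ x) = 0 := fun x => by
    rw [sub_mulVec, dotProduct_sub, h, sub_self]
  have posSemidef : (A - B).PosSemidef :=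
    .of_dotProduct_mulVec_nonneg (hA.sub hB) fun x => (form_eq_zero x).ge
  classical
  refine sub_eq_zero.mp (Matrix.ext_of_mulVec_single fun i => ?_)
  rw [(posSemidef.dotProduct_mulVec_zero_iff _).mp (form_eq_zero _), zero_mulVec]

open scoped MatrixOrder in
theorem exists_pos_sub_smul_one_posSemidef {n : Type*} [Finite n] [DecidableEq n]
    {A : Matrix n n 𝕜} (hA : A.PosDef) :
    ∃ c : ℝ, 0 < c ∧ (A - c • (1 : Matrix n n 𝕜)).PosSemidef := by
  have := Fintype.ofFinite n
  cases isEmpty_or_nonempty n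
  · exact ⟨1, one_pos, Subsingleton.elim 0 (A - _) ▸ .zero⟩
  · obtain ⟨c, hc, hcA⟩ := (CFC.exists_pos_algebraMap_le_iff hA.isHermitian).mpr
      fun x hx => (isStrictlyPositive_iff_posDef.mpr hA).spectrum_pos hx
    exact ⟨c, hc, by rwa [Algebra.algebraMap_eq_smul_one] at hcA⟩

variable [DecidableEq n]

/-- The tangent to the operator-convex function `A ↦ A⁻¹` at `G` lies below it: the difference is
`(A⁻¹ - G⁻¹) A (A⁻¹ - G⁻¹)`. -/
theorem inv_sub_tangent_posSemidef (hA : A.PosDef) (hG : G.PosDef) :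
    (A⁻¹ - (G⁻¹ + G⁻¹ - G⁻¹ * A * G⁻¹)).PosSemidef := by
  have hAdet := (isUnit_iff_isUnit_det _).mp hA.isUnit
  have h := hA.posSemidef.conjTranspose_mul_mul_same (A⁻¹ - G⁻¹)
  rw [(hA.isHermitian.inv.sub hG.isHermitian.inv).eq] at h
  convert h using 1
  rw [Matrix.sub_mul, nonsing_inv_mul _ hAdet, Matrix.sub_mul, Matrix.mul_sub (G⁻¹ * A),
    Matrix.mul_assoc G⁻¹ A A⁻¹, mul_nonsing_inv _ hAdet, Matrix.one_mul, Matrix.mul_one]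
  abel

theorem log_re_det_le_re_trace_sub_card (hA : A.PosDef) :
    Real.log (RCLike.re A.det) ≤ RCLike.re A.trace - Fintype.card n := by
  have trace_eq : RCLike.re A.trace = ∑ i, hA.isHermitian.eigenvalues i := by
    rw [hA.isHermitian.trace_eq_sum_eigenvalues]
    simp only [map_sum, RCLike.ofReal_re]
  have det_eq : RCLike.re A.det = ∏ i, hA.isHermitian.eigenvalues i := by
    rw [hA.isHermitian.det_eq_prod_eigenvalues, ← RCLike.ofReal_prod, RCLike.ofReal_re]
  calc Real.log (RCLike.re A.det)
      = ∑ i, Real.log (hA.isHermitian.eigenvalues i) := by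
        rw [det_eq, Real.log_prod fun i _ => (hA.eigenvalues_pos i).ne']
    _ ≤ ∑ i, (hA.isHermitian.eigenvalues i - 1) :=
        Finset.sum_le_sum fun i _ => Real.log_le_sub_one_of_pos (hA.eigenvalues_pos i)
    _ = RCLike.re A.trace - Fintype.card n := by
        rw [trace_eq, Finset.sum_sub_distrib, Finset.sum_const, nsmul_one, Finset.card_univ]

theorem re_det_pos (hA : A.PosDef) : 0 < RCLike.re A.det :=
  (RCLike.pos_iff.mp hA.det_pos).1

theorem ofReal_re_det (hA : A.IsHermitian) : (RCLike.re A.det : 𝕜) = A.det := by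
  rw [hA.det_eq_prod_eigenvalues, ← RCLike.ofReal_prod, RCLike.ofReal_re]

/-- The tangent to the concave function `log det` at `G` lies above it. -/
theorem log_re_det_le_tangent (hA : A.PosDef) (hG : G.PosDef) :
    Real.log (RCLike.re A.det) ≤
      Real.log (RCLike.re G.det) + RCLike.re (G⁻¹ * A).trace - Fintype.card n := by
  obtain ⟨B, hB⟩ := exists_eq_conjTranspose_mul_self hG.inv.posSemidef
  have hBunit : IsUnit B := isUnit_of_mul_isUnit_right (hB ▸ hG.inv.isUnit)
  have posDef : (B * A * Bᴴ).PosDef :=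
    hA.mul_mul_conjTranspose_same (vecMul_injective_of_isUnit hBunit)
  have trace_eq : (B * A * Bᴴ).trace = (G⁻¹ * A).trace := by
    rw [trace_mul_comm, ← Matrix.mul_assoc, hB]
  have det_eq : RCLike.re (B * A * Bᴴ).det = RCLike.re A.det / RCLike.re G.det := by
    have h : (B * A * Bᴴ).det = G⁻¹.det * A.det := by
      rw [det_mul_comm, ← Matrix.mul_assoc, ← hB, det_mul]
    rw [h, det_nonsing_inv, Ring.inverse_eq_inv', ← ofReal_re_det hA.isHermitian,
      ← ofReal_re_det hG.isHermitian, ← RCLike.ofReal_inv, ← RCLike.ofReal_mul]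
    simp only [RCLike.ofReal_re]
    exact inv_mul_eq_div _ _
  have h := log_re_det_le_re_trace_sub_card posDef
  rw [trace_eq, det_eq, Real.log_div (re_det_pos hA).ne' (re_det_pos hG).ne'] at h
  linarith

end PosSemidef

section Frobenius

open scoped Matrix.Norms.Frobenius

variable {m n 𝕜 : Type*} [Fintype m] [Fintype n] [RCLike 𝕜]

theorem frobenius_norm_sq_eq_sum (A : Matrix m n 𝕜) : ‖A‖ ^ 2 = ∑ i, ∑ j, ‖A i j‖ ^ 2 := by
  rw [frobenius_norm_def, ← Real.sqrt_eq_rpow, Real.sq_sqrt (by positivity)]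
  simp only [Real.rpow_two]

theorem trace_conjTranspose_mul_self_eq_frobenius_norm_sq (A : Matrix m n 𝕜) :
    (Aᴴ * A).trace = ((‖A‖ ^ 2 : ℝ) : 𝕜) := by
  rw [frobenius_norm_sq_eq_sum, Finset.sum_comm]
  simp only [trace, diag_apply, mul_apply, conjTranspose_apply, RCLike.star_def,
    RCLike.conj_mul, RCLike.ofReal_sum, RCLike.ofReal_pow]

theorem norm_apply_le_frobenius_norm (A : Matrix m n 𝕜) (i : m) (j : n) : ‖A i j‖ ≤ ‖A‖ := by
  refine le_of_sq_le_sq ?_ (norm_nonneg A)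
  rw [frobenius_norm_sq_eq_sum]
  exact (Finset.single_le_sum (f := fun j => ‖A i j‖ ^ 2) (fun _ _ => sq_nonneg _)
    (Finset.mem_univ j)).trans (Finset.single_le_sum (f := fun i => ∑ j, ‖A i j‖ ^ 2)
      (fun _ _ => Finset.sum_nonneg fun _ _ => sq_nonneg _) (Finset.mem_univ i))

theorem norm_trace_mul_le (A : Matrix m n 𝕜) (B : Matrix n m 𝕜) :
    ‖(A * B).trace‖ ≤ ‖A‖ * ‖B‖ := by
  rw [← frobenius_norm_transpose B]
  refine le_of_sq_le_sq ?_ (by positivity)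
  calc ‖(A * B).trace‖ ^ 2 ≤ (∑ p : m × n, ‖A p.1 p.2‖ * ‖Bᵀ p.1 p.2‖) ^ 2 := by
        gcongr
        simp only [trace, diag_apply, mul_apply, ← Fintype.sum_prod_type', transpose_apply,
          ← norm_mul]
        exact norm_sum_le _ _
    _ ≤ (∑ p : m × n, ‖A p.1 p.2‖ ^ 2) * ∑ p : m × n, ‖Bᵀ p.1 p.2‖ ^ 2 :=
        Finset.sum_mul_sq_le_sq_mul_sq _ _ _
    _ = (‖A‖ * ‖Bᵀ‖) ^ 2 := by
        rw [mul_pow, frobenius_norm_sq_eq_sum, frobenius_norm_sq_eq_sum,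
          Fintype.sum_prod_type, Fintype.sum_prod_type]

theorem frobenius_norm_le_re_trace {A : Matrix n n 𝕜} (hA : A.PosSemidef) :
    ‖A‖ ≤ RCLike.re A.trace := by
  obtain ⟨B, rfl⟩ := exists_eq_conjTranspose_mul_self hA
  calc ‖Bᴴ * B‖ ≤ ‖Bᴴ‖ * ‖B‖ := frobenius_norm_mul _ _
    _ = RCLike.re (Bᴴ * B).trace := by
      rw [frobenius_norm_conjTranspose, trace_conjTranspose_mul_self_eq_frobenius_norm_sq,
        RCLike.ofReal_re, sq]

/-! ### Linearization of the matrix square root -/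

theorem frobenius_norm_le_div_of_sylvester [DecidableEq n] {S : Matrix m m 𝕜} {T : Matrix n n 𝕜}
    {Y E : Matrix m n 𝕜} {c : ℝ} (hc : 0 < c) (hS : S.PosSemidef)
    (hT : (T - c • (1 : Matrix n n 𝕜)).PosSemidef) (h : S * Y + Y * T = E) : ‖Y‖ ≤ ‖E‖ / c := by
  have left_nonneg := (RCLike.nonneg_iff.mp (hS.conjTranspose_mul_mul_same Y).trace_nonneg).1
  have right_nonneg := (RCLike.nonneg_iff.mp
    (trace_mul_nonneg (posSemidef_conjTranspose_mul_self Y) hT)).1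
  have expand : Yᴴ * E = Yᴴ * S * Y + Yᴴ * Y * (T - c • (1 : Matrix n n 𝕜)) + c • (Yᴴ * Y) := by
    rw [← h, Matrix.mul_add, Matrix.mul_sub, Matrix.mul_smul, Matrix.mul_one]
    simp only [Matrix.mul_assoc]
    abel
  have coercive : c * ‖Y‖ ^ 2 ≤ ‖Y‖ * ‖E‖ := calc
    c * ‖Y‖ ^ 2 ≤ RCLike.re (Yᴴ * E).trace := by
      rw [expand, trace_add, trace_add, trace_smul,
        trace_conjTranspose_mul_self_eq_frobenius_norm_sq, map_add, map_add, RCLike.smul_re,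
        RCLike.ofReal_re]
      linarith
    _ ≤ ‖(Yᴴ * E).trace‖ := RCLike.re_le_norm _
    _ ≤ ‖Y‖ * ‖E‖ := (norm_trace_mul_le _ _).trans_eq (by rw [frobenius_norm_conjTranspose])
  rw [le_div_iff₀ hc]
  rcases (norm_nonneg Y).eq_or_lt with h0 | hpos
  · rw [← h0, zero_mul]
    exact norm_nonneg E
  · nlinarith

section SquareRoot

variable [DecidableEq n] {R S L E : Matrix n n 𝕜} {c : ℝ}

theorem frobenius_norm_sqrt_sub_le (hc : 0 < c) (hR : (R - c • (1 : Matrix n n 𝕜)).PosSemidef)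
    (hS : S.PosSemidef) (hSR : S * S = R * R + E) : ‖S - R‖ ≤ ‖E‖ / c :=
  frobenius_norm_le_div_of_sylvester hc hS hR <| by
    rw [Matrix.mul_sub, Matrix.sub_mul, hSR]
    abel

theorem frobenius_norm_sqrt_sub_sub_le (hc : 0 < c)
    (hR : (R - c • (1 : Matrix n n 𝕜)).PosSemidef) (hS : S.PosSemidef) (hSR : S * S = R * R + E)
    (hL : R * L + L * R = E) : ‖S - R - L‖ ≤ ‖S - R‖ * ‖L‖ / c := by
  refine (frobenius_norm_le_div_of_sylvester (E := -((S - R) * L)) hc hS hR ?_).trans ?_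
  · calc S * (S - R - L) + (S - R - L) * R = S * S - R * R - S * L - L * R := by noncomm_ring
      _ = -((S - R) * L) := by
        rw [hSR, ← hL]
        noncomm_ring
  · rw [norm_neg]
    gcongr
    exact frobenius_norm_mul _ _

theorem norm_trace_mul_sq_sqrt_sub_sub_trace_mul_sq_le (hc : 0 < c)
    (hR : (R - c • (1 : Matrix n n 𝕜)).PosSemidef) (hS : S.PosSemidef) (hSR : S * S = R * R + E)
    (hL : R * L + L * R = E) (P : Matrix n n 𝕜) :
    ‖(P * ((S - R) * (S - R))).trace - (P * (L * L)).trace‖ ≤ 2 * ‖P‖ * ‖E‖ ^ 3 / c ^ 4 := by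
  have hR' : R.PosSemidef := by
    simpa using hR.add (PosSemidef.one.smul hc.le)
  have first_order := frobenius_norm_sqrt_sub_le hc hR hS hSR
  have linear := frobenius_norm_le_div_of_sylvester hc hR' hR hL
  have second_order : ‖S - R - L‖ ≤ ‖E‖ / c * (‖E‖ / c) / c :=
    (frobenius_norm_sqrt_sub_sub_le hc hR hS hSR hL).trans (by gcongr)
  have split : (P * ((S - R) * (S - R))).trace - (P * (L * L)).trace =
      (P * ((S - R) * (S - R - L) + (S - R - L) * L)).trace := by
    rw [← trace_sub]
    noncomm_ring
  calc ‖(P * ((S - R) * (S - R))).trace - (P * (L * L)).trace‖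
      ≤ ‖P‖ * ‖(S - R) * (S - R - L) + (S - R - L) * L‖ := split ▸ norm_trace_mul_le _ _
    _ ≤ ‖P‖ * (‖S - R‖ * ‖S - R - L‖ + ‖S - R - L‖ * ‖L‖) := by
        gcongr
        exact norm_add_le_of_le (frobenius_norm_mul _ _) (frobenius_norm_mul _ _)
    _ ≤ ‖P‖ * (‖E‖ / c * (‖E‖ / c * (‖E‖ / c) / c) + ‖E‖ / c * (‖E‖ / c) / c * (‖E‖ / c)) := by
        gcongr
    _ = 2 * ‖P‖ * ‖E‖ ^ 3 / c ^ 4 := by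
        field_simp
        ring

end SquareRoot

end Frobenius

/-! ### Integration -/

section Integration

/-- Fubini's theorem without `σ`-finiteness of `ν`: the dominating function `g` carries `ν` over to
the finite measure `g dν`. -/
theorem integral_integral_swap_of_norm_le {α β E : Type*} [MeasurableSpace α] [MeasurableSpace β]
    [NormedAddCommGroup E] [NormedSpace ℝ E] {μ : Measure α} [IsFiniteMeasure μ] {ν : Measure β}
    {f : α → β → E} {g : β → ℝ} (hg : Integrable g ν)
    (hf : AEStronglyMeasurable (Function.uncurry f)
      (μ.prod (ν.withDensity fun b => ENNReal.ofReal (g b))))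
    (hfg : ∀ a b, ‖f a b‖ ≤ g b) :
    ∫ a, ∫ b, f a b ∂ν ∂μ = ∫ b, ∫ a, f a b ∂μ ∂ν := by
  rcases isEmpty_or_nonempty α with _ | ⟨⟨a₀⟩⟩
  · simp only [μ.eq_zero_of_isEmpty, integral_zero_measure, integral_zero]
  set ν' := ν.withDensity fun b => ENNReal.ofReal (g b)
  have : IsFiniteMeasure ν' := isFiniteMeasure_withDensity_ofReal hg.hasFiniteIntegral
  have g_nonneg b : 0 ≤ g b := (norm_nonneg (f a₀ b)).trans (hfg a₀ b)
  have integral_weight (h : β → E) : ∫ b, g b • h b ∂ν = ∫ b, h b ∂ν' := by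
    rw [integral_withDensity_eq_integral_toReal_smul₀ hg.aemeasurable.ennreal_ofReal
      (.of_forall fun _ => ENNReal.ofReal_lt_top)]
    simp only [ENNReal.toReal_ofReal (g_nonneg _)]
  have f_eq a b : f a b = g b • (g b)⁻¹ • f a b := by
    rcases eq_or_ne (g b) 0 with h0 | h0
    · rw [norm_le_zero_iff.mp ((hfg a b).trans_eq h0), smul_zero, smul_zero]
    · rw [smul_inv_smul₀ h0]
  have integrable : Integrable (Function.uncurry fun a b => (g b)⁻¹ • f a b) (μ.prod ν') := by
    have hgν' : AEStronglyMeasurable g ν' :=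
      hg.aestronglyMeasurable.mono_ac (withDensity_absolutelyContinuous _ _)
    refine .of_bound (hgν'.comp_snd.inv₀.smul hf) 1 (.of_forall fun ⟨a, b⟩ => ?_)
    rw [Function.uncurry_apply_pair, norm_smul, norm_inv, Real.norm_of_nonneg (g_nonneg b)]
    exact inv_mul_le_one_of_le₀ (hfg a b) (g_nonneg b)
  calc ∫ a, ∫ b, f a b ∂ν ∂μ = ∫ a, ∫ b, (g b)⁻¹ • f a b ∂ν' ∂μ :=
        integral_congr_ae (.of_forall fun a => by
          simp only [← integral_weight, ← f_eq])
    _ = ∫ b, ∫ a, (g b)⁻¹ • f a b ∂μ ∂ν' := integral_integral_swap integrable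
    _ = ∫ b, ∫ a, f a b ∂μ ∂ν := by
        rw [← integral_weight]
        simp only [← integral_smul, ← f_eq]

/-- Compact groups are unimodular. -/
theorem integral_comp_inv_eq_integral {G E : Type*} [Group G] [TopologicalSpace G]
    [IsTopologicalGroup G] [CompactSpace G] [MeasurableSpace G] [BorelSpace G]
    [NormedAddCommGroup E] [NormedSpace ℝ E] [CompleteSpace E] (μ : Measure G) [μ.IsHaarMeasure]
    {f : G → E} (hf : Continuous f) : ∫ x, f x⁻¹ ∂μ = ∫ x, f x ∂μ := by
  have swap : ∫ x, ∫ y, f (x⁻¹ * y) ∂μ ∂μ = ∫ y, ∫ x, f (x⁻¹ * y) ∂μ ∂μ :=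
    integral_integral_swap_of_hasCompactSupport
      (hf.comp' (continuous_fst.inv.mul continuous_snd)) (.of_compactSpace _)
  have inner_left x : ∫ y, f (x⁻¹ * y) ∂μ = ∫ y, f y ∂μ := integral_mul_left_eq_self f x⁻¹
  have inner_right y : ∫ x, f (x⁻¹ * y) ∂μ = ∫ x, f x⁻¹ ∂μ := by
    rw [← integral_mul_left_eq_self (fun x => f x⁻¹) y⁻¹]
    simp only [_root_.mul_inv_rev, inv_inv]
  simp only [inner_left, inner_right] at swap
  rw [integral_const, integral_const] at swap
  exact (smul_right_injective E measureReal_univ_ne_zero swap).symm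

theorem linearMap_apply_eq_sum {m n R : Type*} [Fintype m] [Fintype n] [DecidableEq m]
    [DecidableEq n] [CommSemiring R] (f : Matrix m n R →ₗ[R] R) (A : Matrix m n R) :
    f A = ∑ i, ∑ j, A i j * f (single i j 1) := by
  conv_lhs => rw [matrix_eq_sum_single A]
  simp only [map_sum, ← smul_eq_mul, ← map_smul, smul_single]
  simp only [smul_eq_mul, mul_one]

/-- `A` is the integral of the matrix-valued function `K`. Integrals are taken entry by entry, so
that no norm on matrices has to be chosen. -/
structure HasMatIntegral {Ω m n 𝕜 : Type*} [MeasurableSpace Ω] [RCLike 𝕜] (μ : Measure Ω)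
    (K : Ω → Matrix m n 𝕜) (A : Matrix m n 𝕜) : Prop where
  integrable : ∀ i j, Integrable (fun ω => K ω i j) μ
  integral_eq : ∀ i j, ∫ ω, K ω i j ∂μ = A i j

namespace HasMatIntegral

variable {Ω m n p q 𝕜 : Type*} [MeasurableSpace Ω] [RCLike 𝕜] {μ : Measure Ω}

section Linear

variable [Finite m] [Finite n] {K : Ω → Matrix m n 𝕜} {A : Matrix m n 𝕜}

theorem integrable_linearMap (h : HasMatIntegral μ K A) (f : Matrix m n 𝕜 →ₗ[𝕜] 𝕜) :
    Integrable (fun ω => f (K ω)) μ := by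
  classical
  have := Fintype.ofFinite m
  have := Fintype.ofFinite n
  simp only [linearMap_apply_eq_sum f (K _)]
  exact integrable_finsetSum _ fun i _ => integrable_finsetSum _ fun j _ =>
    (h.integrable i j).mul_const _

theorem integral_linearMap (h : HasMatIntegral μ K A) (f : Matrix m n 𝕜 →ₗ[𝕜] 𝕜) :
    ∫ ω, f (K ω) ∂μ = f A := by
  classical
  have := Fintype.ofFinite m
  have := Fintype.ofFinite n
  rw [linearMap_apply_eq_sum f A]
  simp only [linearMap_apply_eq_sum f (K _)]
  rw [integral_finsetSum _ fun i _ => integrable_finsetSum _ fun j _ =>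
    (h.integrable i j).mul_const _]
  simp_rw [integral_finsetSum _ fun j _ => (h.integrable _ j).mul_const _, integral_mul_const,
    h.integral_eq]

theorem map (h : HasMatIntegral μ K A) (f : Matrix m n 𝕜 →ₗ[𝕜] Matrix p q 𝕜) :
    HasMatIntegral μ (fun ω => f (K ω)) (f A) where
  integrable i j := h.integrable_linearMap (entryLinearMap 𝕜 𝕜 i j ∘ₗ f)
  integral_eq i j := h.integral_linearMap (entryLinearMap 𝕜 𝕜 i j ∘ₗ f)

end Linear

variable [Fintype m] [Fintype n] {K : Ω → Matrix m n 𝕜} {A : Matrix m n 𝕜}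

theorem integrable_dotProduct_mulVec (h : HasMatIntegral μ K A) (x : m → 𝕜) (y : n → 𝕜) :
    Integrable (fun ω => x ⬝ᵥ (K ω *ᵥ y)) μ :=
  h.integrable_linearMap (dotProductBilin 𝕜 𝕜 x ∘ₗ (mulVecBilin 𝕜 𝕜).flip y)

theorem integral_dotProduct_mulVec (h : HasMatIntegral μ K A) (x : m → 𝕜) (y : n → 𝕜) :
    ∫ ω, x ⬝ᵥ (K ω *ᵥ y) ∂μ = x ⬝ᵥ (A *ᵥ y) :=
  h.integral_linearMap (dotProductBilin 𝕜 𝕜 x ∘ₗ (mulVecBilin 𝕜 𝕜).flip y)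

theorem integrable_trace_mul (h : HasMatIntegral μ K A) (S : Matrix n m 𝕜) :
    Integrable (fun ω => (S * K ω).trace) μ :=
  h.integrable_linearMap (traceLinearMap n 𝕜 𝕜 ∘ₗ mulLeftLinearMap n 𝕜 S)

theorem integral_trace_mul (h : HasMatIntegral μ K A) (S : Matrix n m 𝕜) :
    ∫ ω, (S * K ω).trace ∂μ = (S * A).trace :=
  h.integral_linearMap (traceLinearMap n 𝕜 𝕜 ∘ₗ mulLeftLinearMap n 𝕜 S)

section Jensen

variable [DecidableEq n] [IsProbabilityMeasure μ] {K : Ω → Matrix n n 𝕜} {A G W : Matrix n n 𝕜}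

/-- Jensen's inequality for the operator-convex function `A ↦ A⁻¹`. -/
theorem re_trace_mul_inv_le (h : HasMatIntegral μ K A) (hK : ∀ ω, (K ω).PosDef)
    (hG : G.PosDef) (hAG : (G - A).PosSemidef) (hW : W.PosSemidef)
    (hint : Integrable (fun ω => RCLike.re (W * (K ω)⁻¹).trace) μ) :
    RCLike.re (W * G⁻¹).trace ≤ ∫ ω, RCLike.re (W * (K ω)⁻¹).trace ∂μ := by
  have hGdet := (isUnit_iff_isUnit_det _).mp hG.isUnit
  set S := G⁻¹ * W * G⁻¹
  have hS : S.PosSemidef := by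
    simpa only [hG.isHermitian.inv.eq] using hW.mul_mul_conjTranspose_same G⁻¹
  have tangent ω : 2 * RCLike.re (W * G⁻¹).trace - RCLike.re (S * K ω).trace ≤
      RCLike.re (W * (K ω)⁻¹).trace := by
    have h0 := (RCLike.nonneg_iff.mp
      (trace_mul_nonneg hW (inv_sub_tangent_posSemidef (hK ω) hG))).1
    have trace_eq : (W * (G⁻¹ * K ω * G⁻¹)).trace = (S * K ω).trace := by
      rw [← Matrix.mul_assoc, trace_mul_comm]
      simp only [S, Matrix.mul_assoc]
    rw [Matrix.mul_sub, Matrix.mul_sub, Matrix.mul_add, trace_sub, trace_sub, trace_add,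
      trace_eq, map_sub, map_sub, map_add] at h0
    linarith
  have mean_le : RCLike.re (S * A).trace ≤ RCLike.re (W * G⁻¹).trace := by
    have h0 := (RCLike.nonneg_iff.mp (trace_mul_nonneg hS hAG)).1
    have trace_eq : (S * G).trace = (W * G⁻¹).trace := by
      rw [Matrix.mul_assoc, nonsing_inv_mul _ hGdet, Matrix.mul_one, trace_mul_comm]
    rw [Matrix.mul_sub, trace_sub, trace_eq, map_sub] at h0
    linarith
  calc RCLike.re (W * G⁻¹).trace
      ≤ 2 * RCLike.re (W * G⁻¹).trace - RCLike.re (S * A).trace := by linarith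
    _ = ∫ ω, (2 * RCLike.re (W * G⁻¹).trace - RCLike.re (S * K ω).trace) ∂μ := by
        rw [integral_sub (integrable_const _) (h.integrable_trace_mul S).re, integral_const,
          probReal_univ, one_smul, integral_re (h.integrable_trace_mul S), h.integral_trace_mul]
    _ ≤ ∫ ω, RCLike.re (W * (K ω)⁻¹).trace ∂μ :=
        integral_mono ((integrable_const _).sub (h.integrable_trace_mul S).re) hint tangent

/-- Jensen's inequality for the concave function `log det`. -/
theorem integral_log_re_det_le (h : HasMatIntegral μ K A) (hK : ∀ ω, (K ω).PosDef)
    (hG : G.PosDef) (hAG : (G - A).PosSemidef)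
    (hint : Integrable (fun ω => Real.log (RCLike.re (K ω).det)) μ) :
    ∫ ω, Real.log (RCLike.re (K ω).det) ∂μ ≤ Real.log (RCLike.re G.det) := by
  have mean_le : RCLike.re (G⁻¹ * A).trace ≤ Fintype.card n := by
    have h0 := (RCLike.nonneg_iff.mp (trace_mul_nonneg hG.inv.posSemidef hAG)).1
    rw [Matrix.mul_sub, nonsing_inv_mul _ ((isUnit_iff_isUnit_det _).mp hG.isUnit), trace_sub,
      trace_one, map_sub, RCLike.natCast_re] at h0
    linarith
  have htr := (h.integrable_trace_mul G⁻¹).re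
  have hadd : Integrable (fun ω => Real.log (RCLike.re G.det) + RCLike.re (G⁻¹ * K ω).trace) μ :=
    (integrable_const _).add htr
  calc ∫ ω, Real.log (RCLike.re (K ω).det) ∂μ
      ≤ ∫ ω, (Real.log (RCLike.re G.det) + RCLike.re (G⁻¹ * K ω).trace - Fintype.card n) ∂μ :=
        integral_mono hint (hadd.sub (integrable_const _))
          fun ω => log_re_det_le_tangent (hK ω) hG
    _ = Real.log (RCLike.re G.det) + RCLike.re (G⁻¹ * A).trace - Fintype.card n := by
        rw [integral_sub hadd (integrable_const _),
          integral_add (integrable_const _) htr, integral_const, integral_const, probReal_univ,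
          one_smul, one_smul, integral_re (h.integrable_trace_mul G⁻¹), h.integral_trace_mul]
    _ ≤ Real.log (RCLike.re G.det) := by linarith

end Jensen

end HasMatIntegral

end Integration

/-! ### Fisher information of an outcome operator -/

section FisherForm

variable {n 𝕜 : Type*} [Fintype n] [RCLike 𝕜]

/-- The Fisher information that an outcome with outcome operator `A` carries about a displacement
of the state `σ` in the direction `X`. It is `⟨⟨X| (|A⟩⟩ tr(Aσ)⁻¹ ⟨⟨A|) |X⟩⟩`, the contribution of
`A` to the frame superoperator, and vanishes by the convention `x / 0 = 0` if `A = 0`. -/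
def fisherForm (σ X A : Matrix n n 𝕜) : ℝ :=
  ‖(A * X).trace‖ ^ 2 / RCLike.re (A * σ).trace

variable {σ A : Matrix n n 𝕜}

theorem fisherForm_zero (σ X : Matrix n n 𝕜) : fisherForm σ X 0 = 0 := by
  simp only [fisherForm, Matrix.zero_mul, trace_zero, map_zero, div_zero]

theorem fisherForm_smul (σ X : Matrix n n 𝕜) (c : ℝ) (A : Matrix n n 𝕜) :
    fisherForm σ X (c • A) = c * fisherForm σ X A := by
  rcases eq_or_ne c 0 with rfl | hc
  · rw [zero_smul, zero_mul, fisherForm_zero]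
  · simp only [fisherForm, Matrix.smul_mul, trace_smul, norm_smul, Real.norm_eq_abs, RCLike.smul_re,
      mul_pow, sq_abs]
    rw [sq, mul_assoc, mul_div_mul_left _ _ hc, mul_div_assoc]

theorem fisherForm_nonneg (hσ : σ.PosSemidef) (X : Matrix n n 𝕜) (hA : A.PosSemidef) :
    0 ≤ fisherForm σ X A :=
  div_nonneg (sq_nonneg _) (RCLike.nonneg_iff.mp (trace_mul_nonneg hA hσ)).1

theorem mul_re_trace_le_re_trace_mul [DecidableEq n] {c : ℝ}
    (hσ : (σ - c • (1 : Matrix n n 𝕜)).PosSemidef) (hA : A.PosSemidef) :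
    c * RCLike.re A.trace ≤ RCLike.re (A * σ).trace := by
  have h := (RCLike.nonneg_iff.mp (trace_mul_nonneg hA hσ)).1
  rw [Matrix.mul_sub, Matrix.mul_smul, Matrix.mul_one, trace_sub, trace_smul, map_sub,
    RCLike.smul_re] at h
  exact sub_nonneg.mp h

theorem re_trace_pos (hA : A.PosSemidef) (hA0 : A ≠ 0) : 0 < RCLike.re A.trace := by
  obtain ⟨re_nonneg, im_eq⟩ := RCLike.nonneg_iff.mp hA.trace_nonneg
  refine re_nonneg.lt_of_ne' fun re_eq => hA0 (hA.trace_eq_zero_iff.mp ?_)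
  exact RCLike.ext (re_eq.trans (map_zero _).symm) (im_eq.trans (map_zero _).symm)

theorem re_trace_mul_pos (hσ : σ.PosDef) (hA : A.PosSemidef) (hA0 : A ≠ 0) :
    0 < RCLike.re (A * σ).trace := by
  classical
  obtain ⟨c, hc, hσc⟩ := exists_pos_sub_smul_one_posSemidef hσ
  exact (mul_pos hc (re_trace_pos hA hA0)).trans_le (mul_re_trace_le_re_trace_mul hσc hA)

theorem fisherForm_sum_le {ι : Type*} (s : Finset ι) (hσ : σ.PosDef) (X : Matrix n n 𝕜)
    {A : ι → Matrix n n 𝕜} (hA : ∀ k ∈ s, (A k).PosSemidef) :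
    fisherForm σ X (∑ k ∈ s, A k) ≤ ∑ k ∈ s, fisherForm σ X (A k) := by
  have prob_nonneg k (hk : k ∈ s) : 0 ≤ RCLike.re (A k * σ).trace :=
    (RCLike.nonneg_iff.mp (trace_mul_nonneg (hA k hk) hσ.posSemidef)).1
  have form_nonneg k (hk : k ∈ s) : 0 ≤ fisherForm σ X (A k) :=
    fisherForm_nonneg hσ.posSemidef X (hA k hk)
  have sq_le k (hk : k ∈ s) :
      ‖(A k * X).trace‖ ^ 2 ≤ RCLike.re (A k * σ).trace * fisherForm σ X (A k) := by
    rcases eq_or_ne (A k) 0 with h0 | h0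
    · simp only [h0, trace_zero, norm_zero, map_zero, zero_mul, zero_pow two_ne_zero, le_refl]
    · exact (mul_div_cancel₀ _ (re_trace_mul_pos hσ (hA k hk) h0).ne').ge
  simp only [fisherForm, Finset.sum_mul, trace_sum, map_sum] at *
  refine div_le_of_le_mul₀ (Finset.sum_nonneg prob_nonneg) (Finset.sum_nonneg form_nonneg) ?_
  rw [mul_comm]
  calc ‖∑ k ∈ s, (A k * X).trace‖ ^ 2 ≤ (∑ k ∈ s, ‖(A k * X).trace‖) ^ 2 :=
        pow_le_pow_left₀ (norm_nonneg _) (norm_sum_le _ _) 2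
    _ ≤ _ := Finset.sum_sq_le_sum_mul_sum_of_sq_le_mul s prob_nonneg form_nonneg sq_le

open scoped Matrix.Norms.Frobenius in
theorem fisherForm_le [DecidableEq n] {c : ℝ} (hc : 0 < c)
    (hσ : (σ - c • (1 : Matrix n n 𝕜)).PosSemidef) (X : Matrix n n 𝕜) (hA : A.PosSemidef) :
    fisherForm σ X A ≤ ‖X‖ ^ 2 / c * RCLike.re A.trace := by
  rcases eq_or_ne A 0 with rfl | hA0
  · rw [fisherForm_zero, trace_zero, map_zero, mul_zero]
  have tr_pos := re_trace_pos hA hA0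
  have overlap_le : ‖(A * X).trace‖ ≤ RCLike.re A.trace * ‖X‖ :=
    (norm_trace_mul_le A X).trans (by gcongr; exact frobenius_norm_le_re_trace hA)
  calc fisherForm σ X A ≤ (RCLike.re A.trace * ‖X‖) ^ 2 / (c * RCLike.re A.trace) := by
        unfold fisherForm
        gcongr
        exact mul_re_trace_le_re_trace_mul hσ hA
    _ = ‖X‖ ^ 2 / c * RCLike.re A.trace := by field_simp

end FisherForm

/-! ### Unitary conjugation -/

section Conj

variable {d : ℕ}

theorem conj_eq_conjStarAlgAut (V : U d) (A : Op d) :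
    conj V A = Unitary.conjStarAlgAut ℂ (Op d) V A := rfl

theorem conj_one (A : Op d) : conj 1 A = A := by
  simp only [conj_eq_conjStarAlgAut, map_one, StarAlgEquiv.one_apply]

theorem conj_one_right (V : U d) : conj V 1 = 1 :=
  map_one (Unitary.conjStarAlgAut ℂ (Op d) V)

theorem conj_inv_conj (V : U d) (A : Op d) : conj V⁻¹ (conj V A) = A := by
  rw [← conj_mul, inv_mul_cancel, conj_one]

theorem conj_sub (V : U d) (A B : Op d) : conj V (A - B) = conj V A - conj V B :=
  map_sub (Unitary.conjStarAlgAut ℂ (Op d) V) A B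

theorem conj_smul (V : U d) (c : ℂ) (A : Op d) : conj V (c • A) = c • conj V A :=
  map_smul (Unitary.conjStarAlgAut ℂ (Op d) V) c A

theorem conj_mul_conj (V : U d) (A B : Op d) : conj V A * conj V B = conj V (A * B) :=
  (map_mul (Unitary.conjStarAlgAut ℂ (Op d) V) A B).symm

theorem conjTranspose_conj (V : U d) (A : Op d) : (conj V A)ᴴ = conj V Aᴴ :=
  (map_star (Unitary.conjStarAlgAut ℂ (Op d) V) A).symm

theorem trace_conj (V : U d) (A : Op d) : (conj V A).trace = A.trace := by
  rw [conj, trace_mul_comm, ← Matrix.mul_assoc, star_mul_coe, Matrix.one_mul]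

theorem posSemidef_conj (V : U d) {A : Op d} (hA : A.PosSemidef) : (conj V A).PosSemidef :=
  hA.mul_mul_conjTranspose_same _

theorem posDef_conj (V : U d) {A : Op d} (hA : A.PosDef) : (conj V A).PosDef :=
  hA.mul_mul_conjTranspose_same (vecMul_injective_of_isUnit (Unitary.toUnits V).isUnit)

theorem IsFullRankState.conj {ρ : Op d} (hρ : IsFullRankState ρ) (V : U d) :
    IsFullRankState (conj V ρ) :=
  ⟨posDef_conj V hρ.1, (trace_conj V ρ).trans hρ.2⟩

theorem IsFullRankState.isState {ρ : Op d} (hρ : IsFullRankState ρ) : IsState ρ :=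
  ⟨hρ.1.posSemidef, hρ.2⟩

theorem IsFullRankState.neZero {ρ : Op d} (hρ : IsFullRankState ρ) : NeZero d :=
  ⟨by rintro rfl; simpa using hρ.2⟩

theorem fisherForm_conj (σ X A : Op d) (V : U d) :
    fisherForm (conj V σ) (conj V X) A = fisherForm σ X (conj V⁻¹ A) := by
  have trace_mul_conj (Y : Op d) : (A * conj V Y).trace = (conj V⁻¹ A * Y).trace := by
    rw [← trace_conj V⁻¹, ← conj_mul_conj, conj_inv_conj]
  simp only [fisherForm, trace_mul_conj]

theorem posSemidef_single_zero (d : ℕ) [NeZero d] : (single 0 0 1 : Op d).PosSemidef := by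
  rw [← diagonal_single]
  exact .diagonal (Pi.single_nonneg.mpr zero_le_one)

theorem exists_conj_single_zero [NeZero d] (k : Fin d) :
    ∃ V : U d, conj V (single 0 0 1) = single k k 1 := by
  have swap_mem : (Equiv.swap 0 k).permMatrix ℂ ∈ U d := by
    rw [mem_unitaryGroup_iff, star_eq_conjTranspose, conjTranspose_permMatrix, ← permMatrix_mul,
      Equiv.Perm.inv_def, Equiv.symm_swap, Equiv.swap_mul_self, permMatrix_one]
  refine ⟨⟨_, swap_mem⟩, ?_⟩
  ext i j
  simp [conj, conjTranspose_permMatrix, Equiv.Perm.permMatrix, PEquiv.toMatrix_toPEquiv_mul,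
    PEquiv.mul_toMatrix_toPEquiv, single_apply, Equiv.swap_apply_def]
  grind

/-- The spectral decomposition, with the eigenprojectors written as unitary images of `|0⟩⟨0|`. -/
theorem exists_eq_sum_eigenvalues_smul_conj [NeZero d] {A : Op d} (hA : A.IsHermitian) :
    ∃ W : Fin d → U d, A = ∑ k, hA.eigenvalues k • conj (W k) (single 0 0 1) := by
  choose P hP using exists_conj_single_zero (d := d)
  refine ⟨fun k => hA.eigenvectorUnitary * P k, ?_⟩
  have diagonal_eq : diagonal (RCLike.ofReal ∘ hA.eigenvalues) =
      ∑ k, (hA.eigenvalues k : ℂ) • single k k (1 : ℂ) := by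
    simp only [smul_single, smul_eq_mul, mul_one, sum_single_eq_diagonal]
    rfl
  conv_lhs => rw [hA.spectral_theorem, diagonal_eq, map_sum]
  refine Finset.sum_congr rfl fun k _ => ?_
  rw [conj_mul, hP, conj_eq_conjStarAlgAut, map_smul]
  rfl

end Conj

/-! ### Haar averages -/

section Haar

variable {d : ℕ} {σ A : Op d}

instance : SecondCountableTopology (U d) :=
  have : SecondCountableTopology (Op d) :=
    inferInstanceAs (SecondCountableTopology (Fin d → Fin d → ℂ))
  TopologicalSpace.Subtype.secondCountableTopology _

theorem integrable_haarU {f : U d → ℝ} (hf : Continuous f) : Integrable f (haarU d) :=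
  hf.integrable_of_hasCompactSupport (.of_compactSpace f)

theorem continuous_fisherForm_conj (hσ : σ.PosDef) (X : Op d) (hA : A.PosSemidef) :
    Continuous fun V : U d => fisherForm σ X (conj V A) := by
  rcases eq_or_ne A 0 with rfl | hA0
  · have conj_zero (V : U d) : conj V 0 = 0 := by simp only [conj, Matrix.mul_zero, Matrix.zero_mul]
    simp only [conj_zero, continuous_const]
  have conj_ne_zero (V : U d) : conj V A ≠ 0 := fun h0 => hA0 <| hA.trace_eq_zero_iff.mp <| by
    rw [← trace_conj V, h0, trace_zero]
  have continuous_trace (Y : Op d) : Continuous fun V : U d => (conj V A * Y).trace :=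
    ((continuous_conj A).matrix_mul continuous_const).matrix_trace
  exact ((continuous_trace X).norm.pow 2).div (RCLike.continuous_re.comp (continuous_trace σ))
    fun V => (re_trace_mul_pos hσ (posSemidef_conj V hA) (conj_ne_zero V)).ne'

/-- Among the outcome operators of given trace, pure ones carry the most Fisher information on
average: the average is convex in `A`, and the eigenprojectors of `A` all have the same average. -/
theorem integral_fisherForm_conj_le [NeZero d] (hσ : σ.PosDef) (X : Op d) (hA : A.PosSemidef) :
    ∫ V, fisherForm σ X (conj V⁻¹ A) ∂haarU d ≤
      A.trace.re * ∫ V, fisherForm σ X (conj V (single 0 0 1)) ∂haarU d := by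
  obtain ⟨W, hW⟩ := exists_eq_sum_eigenvalues_smul_conj hA.isHermitian
  set l := hA.isHermitian.eigenvalues with hl
  set E : Op d := single 0 0 1
  have hE : E.PosSemidef := posSemidef_single_zero d
  have continuous_inv {B : Op d} (hB : B.PosSemidef) :
      Continuous fun V : U d => fisherForm σ X (conj V⁻¹ B) :=
    (continuous_fisherForm_conj hσ X hB).comp continuous_inv
  have integrable k : Integrable (fun V => l k * fisherForm σ X (conj V⁻¹ (conj (W k) E)))
      (haarU d) :=
    (integrable_haarU (continuous_inv (posSemidef_conj _ hE))).const_mul _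
  have pointwise (V : U d) : fisherForm σ X (conj V⁻¹ A) ≤
      ∑ k, l k * fisherForm σ X (conj V⁻¹ (conj (W k) E)) := by
    have conj_eq : conj V⁻¹ A = ∑ k, l k • conj V⁻¹ (conj (W k) E) := by
      conv_lhs => rw [hW, conj_eq_conjStarAlgAut, map_sum]
      exact Finset.sum_congr rfl fun k _ => conj_smul V⁻¹ (l k : ℂ) _
    simp only [conj_eq, ← fisherForm_smul]
    exact fisherForm_sum_le _ hσ X fun k _ =>
      (posSemidef_conj _ (posSemidef_conj _ hE)).smul (hA.eigenvalues_nonneg k)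
  have average_pure k : ∫ V, fisherForm σ X (conj V⁻¹ (conj (W k) E)) ∂haarU d =
      ∫ V, fisherForm σ X (conj V E) ∂haarU d := by
    rw [← integral_comp_inv_eq_integral (haarU d) (continuous_fisherForm_conj hσ X hE),
      ← integral_mul_left_eq_self (fun V => fisherForm σ X (conj V⁻¹ E)) (W k)⁻¹]
    simp only [_root_.mul_inv_rev, inv_inv, conj_mul]
  have trace_eq : A.trace.re = ∑ k, l k := by
    rw [hA.isHermitian.trace_eq_sum_eigenvalues]
    simp only [Complex.re_sum, RCLike.ofReal_eq_complex_ofReal, Complex.ofReal_re, hl]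
  calc ∫ V, fisherForm σ X (conj V⁻¹ A) ∂haarU d
      ≤ ∫ V, ∑ k, l k * fisherForm σ X (conj V⁻¹ (conj (W k) E)) ∂haarU d :=
        integral_mono (integrable_haarU (continuous_inv hA))
          (integrable_finsetSum _ fun k _ => integrable k) pointwise
    _ = ∑ k, l k * ∫ V, fisherForm σ X (conj V E) ∂haarU d := by
        rw [integral_finsetSum _ fun k _ => integrable k]
        simp only [integral_const_mul, average_pure]
    _ = A.trace.re * ∫ V, fisherForm σ X (conj V E) ∂haarU d := by
        rw [trace_eq, Finset.sum_mul]

end Haar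

/-! ### The frame superoperator -/

section FrameKernel

variable {d : ℕ} {σ A : Op d}

theorem ofReal_re_trace_mul (hA : A.IsHermitian) (hσ : σ.IsHermitian) :
    ((A * σ).trace.re : ℂ) = (A * σ).trace := by
  rw [← Complex.conj_eq_iff_re, starRingEnd_apply, ← trace_conjTranspose, conjTranspose_mul,
    hA.eq, hσ.eq, trace_mul_comm]

theorem star_one_vec_dotProduct (A : Op d) : star (1 : Op d).vec ⬝ᵥ A.vec = A.trace := by
  rw [star_vec_dotProduct_vec, conjTranspose_one, Matrix.one_mul]

theorem ketBra_mulVec (A B : Op d) (v : Fin d × Fin d → ℂ) :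
    ketBra A B *ᵥ v = (star B.vec ⬝ᵥ v) • A.vec := by
  rw [ketBra, vecMulVec_mulVec, op_smul_eq_smul]

theorem conjTranspose_ketBra (A B : Op d) : (ketBra A B)ᴴ = ketBra B A := by
  rw [ketBra, conjTranspose_vecMulVec, star_star, ketBra]

/-- The integrand `|A⟩⟩ tr(A σ)⁻¹ ⟨⟨A|` of the frame superoperator. -/
def frameKernel (σ A : Op d) : SuperOp d := (((A * σ).trace.re : ℂ)⁻¹) • ketBra A A

theorem frameKernel_isHermitian (σ A : Op d) : (frameKernel σ A).IsHermitian := by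
  rw [IsHermitian, frameKernel, conjTranspose_smul, conjTranspose_ketBra, star_inv₀,
    Complex.star_def, Complex.conj_ofReal]

theorem frameKernel_swap (σ : Op d) (hA : A.IsHermitian) (i j : Fin d × Fin d) :
    frameKernel σ A i.swap j.swap = star (frameKernel σ A i j) := by
  have vec_swap (k : Fin d × Fin d) : A.vec k.swap = star (A.vec k) := (hA.apply k.1 k.2).symm
  simp only [frameKernel, ketBra, Matrix.smul_apply, vecMulVec_apply, Pi.star_apply, vec_swap,
    star_smul, star_mul', star_inv₀, Complex.star_def, Complex.conj_ofReal]

open scoped Matrix.Norms.Frobenius in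
theorem norm_frameKernel_apply_le {c : ℝ} (hc : 0 < c) (hσ : (σ - c • (1 : Op d)).PosSemidef)
    (hA : A.PosSemidef) (i j : Fin d × Fin d) : ‖frameKernel σ A i j‖ ≤ c⁻¹ * A.trace.re := by
  rcases eq_or_ne A 0 with rfl | hA0
  · simp only [frameKernel, ketBra, vec_zero, zero_vecMulVec, smul_zero, Matrix.zero_apply,
      norm_zero, trace_zero, Complex.zero_re, mul_zero, le_refl]
  have tr_pos : 0 < A.trace.re := re_trace_pos hA hA0
  have prob_ge : c * A.trace.re ≤ (A * σ).trace.re := mul_re_trace_le_re_trace_mul hσ hA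
  have norm_entry_le (k : Fin d × Fin d) : ‖A.vec k‖ ≤ A.trace.re :=
    (norm_apply_le_frobenius_norm A k.2 k.1).trans (frobenius_norm_le_re_trace hA)
  calc ‖frameKernel σ A i j‖ = ((A * σ).trace.re)⁻¹ * (‖A.vec i‖ * ‖A.vec j‖) := by
        simp only [frameKernel, ketBra, Matrix.smul_apply, vecMulVec_apply, Pi.star_apply,
          norm_smul, norm_inv, Complex.norm_of_nonneg ((mul_pos hc tr_pos).le.trans prob_ge),
          norm_mul, norm_star]
    _ ≤ (c * A.trace.re)⁻¹ * (A.trace.re * A.trace.re) := by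
        gcongr
        exacts [norm_entry_le i, norm_entry_le j]
    _ = c⁻¹ * A.trace.re := by field_simp

theorem star_vec_dotProduct_frameKernel_mulVec (σ X : Op d) (hA : A.IsHermitian) :
    star X.vec ⬝ᵥ (frameKernel σ A *ᵥ X.vec) = (fisherForm σ X A : ℂ) := by
  have overlap : star X.vec ⬝ᵥ A.vec = star (A * X).trace := by
    rw [star_vec_dotProduct_vec, ← trace_conjTranspose, conjTranspose_mul, hA.eq]
  rw [frameKernel, smul_mulVec, ketBra_mulVec, dotProduct_smul, dotProduct_smul, overlap,
    star_vec_dotProduct_vec, hA.eq, smul_eq_mul, smul_eq_mul, Complex.star_def, Complex.mul_conj',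
    fisherForm, RCLike.re_eq_complex_re, Complex.ofReal_div, Complex.ofReal_pow, div_eq_inv_mul]

theorem frameKernel_mulVec_state (hσ : σ.PosDef) (hA : A.PosSemidef) :
    frameKernel σ A *ᵥ σ.vec = A.vec := by
  rcases eq_or_ne A 0 with rfl | hA0
  · simp only [frameKernel, ketBra, vec_zero, zero_vecMulVec, smul_zero, zero_mulVec]
  have prob_ne_zero : ((A * σ).trace.re : ℂ) ≠ 0 :=
    Complex.ofReal_ne_zero.mpr (re_trace_mul_pos hσ hA hA0).ne'
  have trace_eq := ofReal_re_trace_mul hA.isHermitian hσ.isHermitian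
  rw [frameKernel, smul_mulVec, ketBra_mulVec, star_vec_dotProduct_vec, hA.isHermitian.eq,
    trace_eq, inv_smul_smul₀ (trace_eq ▸ prob_ne_zero)]

theorem continuous_frameKernel_conj (hσ : σ.PosDef) (hA : A.PosSemidef) :
    Continuous fun V : U d => frameKernel (conj V σ) A := by
  rcases eq_or_ne A 0 with rfl | hA0
  · simp only [frameKernel, ketBra, vec_zero, zero_vecMulVec, smul_zero]
    exact continuous_const
  have continuous_prob : Continuous fun V : U d => ((A * conj V σ).trace.re : ℂ) :=
    Complex.continuous_ofReal.comp (Complex.continuous_re.comp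
      (continuous_const.matrix_mul (continuous_conj σ)).matrix_trace)
  refine (continuous_prob.inv₀ fun V => Complex.ofReal_ne_zero.mpr ?_).smul continuous_const
  exact (re_trace_mul_pos (posDef_conj V hσ) hA hA0).ne'

end FrameKernel

namespace Measurement

variable {d : ℕ} {Ω : Type*} [MeasurableSpace Ω] (M : Measurement d Ω) {σ : Op d}

theorem hasMatIntegral_op : HasMatIntegral M.ref M.op 1 :=
  ⟨M.integrable, M.integral_eq⟩

theorem integral_trace_op_mul (X : Op d) : ∫ ξ, (M.op ξ * X).trace ∂M.ref = X.trace := by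
  simp only [trace_mul_comm _ X, M.hasMatIntegral_op.integral_trace_mul, Matrix.mul_one]

theorem integrable_re_trace_op : Integrable (fun ξ => (M.op ξ).trace.re) M.ref := by
  have h := (M.hasMatIntegral_op.integrable_trace_mul 1).re
  simp only [Matrix.one_mul] at h
  exact h

theorem integral_re_trace_op : ∫ ξ, (M.op ξ).trace.re ∂M.ref = d := by
  have h := integral_re (M.hasMatIntegral_op.integrable_trace_mul 1)
  rw [M.hasMatIntegral_op.integral_trace_mul] at h
  simp only [Matrix.one_mul, trace_one, Fintype.card_fin, RCLike.natCast_re] at h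
  exact h

theorem aestronglyMeasurable_frameKernel (σ : Op d) (i j : Fin d × Fin d) :
    AEStronglyMeasurable (fun ξ => frameKernel σ (M.op ξ) i j) M.ref := by
  have prob_measurable : AEStronglyMeasurable (fun ξ => ((M.op ξ * σ).trace.re : ℂ)⁻¹) M.ref := by
    simp only [trace_mul_comm _ σ]
    exact (Complex.measurable_ofReal.comp_aemeasurable (M.hasMatIntegral_op.integrable_trace_mul
      σ).re.aestronglyMeasurable.aemeasurable).inv.aestronglyMeasurable
  exact prob_measurable.mul ((M.integrable i.2 i.1).aestronglyMeasurable.mul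
    (continuous_star.comp_aestronglyMeasurable (M.integrable j.2 j.1).aestronglyMeasurable))

theorem hasMatIntegral_frameKernel (hσ : σ.PosDef) :
    HasMatIntegral M.ref (fun ξ => frameKernel σ (M.op ξ)) (M.frame σ) := by
  obtain ⟨c, hc, hσc⟩ := exists_pos_sub_smul_one_posSemidef hσ
  refine ⟨fun i j => ?_, fun i j => rfl⟩
  exact (M.integrable_re_trace_op.const_mul c⁻¹).mono' (M.aestronglyMeasurable_frameKernel σ i j)
    (.of_forall fun ξ => norm_frameKernel_apply_le hc hσc (M.posSemidef ξ) i j)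

theorem continuous_frame_conj (hσ : σ.PosDef) : Continuous fun V : U d => M.frame (conj V σ) := by
  obtain ⟨c, hc, hσc⟩ := exists_pos_sub_smul_one_posSemidef hσ
  have conj_sub_posSemidef (V : U d) : (conj V σ - c • (1 : Op d)).PosSemidef := by
    have h := posSemidef_conj V hσc
    rwa [conj_sub, ← Complex.coe_smul, conj_smul, conj_one_right] at h
  refine continuous_matrix fun i j => continuous_of_dominated
    (F := fun V ξ => frameKernel (conj V σ) (M.op ξ) i j)
    (bound := fun ξ => c⁻¹ * (M.op ξ).trace.re)
    (fun V => M.aestronglyMeasurable_frameKernel _ i j) (fun V => .of_forall fun ξ => ?_)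
    (M.integrable_re_trace_op.const_mul _) (.of_forall fun ξ => ?_)
  · exact norm_frameKernel_apply_le hc (conj_sub_posSemidef V) (M.posSemidef ξ) i j
  · exact (continuous_frameKernel_conj hσ (M.posSemidef ξ)).matrix_elem i j

theorem frame_isHermitian (σ : Op d) : (M.frame σ).IsHermitian := .ext fun i j => by
  change star (∫ ξ, frameKernel σ (M.op ξ) j i ∂M.ref) = ∫ ξ, frameKernel σ (M.op ξ) i j ∂M.ref
  simp only [← (frameKernel_isHermitian σ _).apply i j, ← starRingEnd_apply,
    ← _root_.integral_conj]

theorem frame_swap (σ : Op d) (i j : Fin d × Fin d) :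
    M.frame σ i.swap j.swap = star (M.frame σ i j) := by
  change ∫ ξ, frameKernel σ (M.op ξ) i.swap j.swap ∂M.ref = star (∫ ξ, frameKernel σ _ i j ∂M.ref)
  simp only [frameKernel_swap σ (M.posSemidef _).isHermitian, ← starRingEnd_apply,
    _root_.integral_conj]

theorem frame_mulVec_conjTranspose {X Y : Op d} (h : M.frame σ *ᵥ X.vec = Y.vec) :
    M.frame σ *ᵥ Xᴴ.vec = Yᴴ.vec := by
  ext i
  calc ∑ j, M.frame σ i j * Xᴴ.vec j = ∑ j, star (M.frame σ i.swap j * X.vec j) :=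
        Fintype.sum_equiv (Equiv.prodComm _ _) _ _ fun j => by
          rw [star_mul', ← frame_swap]
          rfl
    _ = star ((M.frame σ *ᵥ X.vec) i.swap) := (star_sum _ _).symm
    _ = Yᴴ.vec i := by rw [h]; rfl

theorem frame_mulVec_state (hσ : σ.PosDef) : M.frame σ *ᵥ σ.vec = (1 : Op d).vec := by
  ext i
  have h := (M.hasMatIntegral_frameKernel hσ).integral_dotProduct_mulVec (Pi.single i 1) σ.vec
  simp only [frameKernel_mulVec_state hσ (M.posSemidef _), single_one_dotProduct] at h
  exact h.symm.trans (M.integral_eq i.2 i.1)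

theorem integrable_fisherForm (hσ : σ.PosDef) (X : Op d) :
    Integrable (fun ξ => fisherForm σ X (M.op ξ)) M.ref := by
  have h := (M.hasMatIntegral_frameKernel hσ).integrable_dotProduct_mulVec (star X.vec) X.vec
  simp only [star_vec_dotProduct_frameKernel_mulVec σ X (M.posSemidef _).isHermitian] at h
  exact h.re

theorem star_vec_dotProduct_frame_mulVec (hσ : σ.PosDef) (X : Op d) :
    star X.vec ⬝ᵥ (M.frame σ *ᵥ X.vec) = ((∫ ξ, fisherForm σ X (M.op ξ) ∂M.ref : ℝ) : ℂ) := by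
  have h := (M.hasMatIntegral_frameKernel hσ).integral_dotProduct_mulVec (star X.vec) X.vec
  simp only [star_vec_dotProduct_frameKernel_mulVec σ X (M.posSemidef _).isHermitian] at h
  exact h.symm.trans integral_ofReal

end Measurement

/-! ### Informational completeness -/

open scoped Matrix.Norms.L2Operator MatrixOrder in
theorem eventually_posSemidef_add_smul {n : Type*} [Finite n] {A X : Matrix n n ℂ}
    (hA : A.PosDef) (hX : X.IsHermitian) :
    ∀ᶠ t : ℝ in 𝓝 0, (A + t • X).PosSemidef := by
  classical
  have := Fintype.ofFinite n
  obtain ⟨c, hc, hAc⟩ := exists_pos_sub_smul_one_posSemidef hA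
  have small : ∀ᶠ t : ℝ in 𝓝 0, ‖t • X‖ < c :=
    (Continuous.norm (by fun_prop)).continuousAt.eventually_lt continuousAt_const
      (by rwa [zero_smul, norm_zero])
  filter_upwards [small] with t ht
  have lower : (t • X + ‖t • X‖ • (1 : Matrix n n ℂ)).PosSemidef := by
    have h := IsSelfAdjoint.neg_algebraMap_norm_le_self (a := t • X)
      (ha := IsSelfAdjoint.smul (.all t) hX)
    rwa [Matrix.le_iff, sub_neg_eq_add, Algebra.algebraMap_eq_smul_one] at h
  have gap : ((c - ‖t • X‖) • (1 : Matrix n n ℂ)).PosSemidef :=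
    PosSemidef.one.smul (sub_nonneg.mpr ht.le)
  simpa only [sub_smul, sub_add_sub_cancel, sub_add_add_cancel] using (hAc.add gap).add lower

theorem IsFullRankState.eventually_isState_add_smul {d : ℕ} {ρ X : Op d}
    (hρ : IsFullRankState ρ) (hX : X.IsHermitian) (htr : X.trace = 0) :
    ∀ᶠ t : ℝ in 𝓝 0, IsState (ρ + t • X) := by
  filter_upwards [eventually_posSemidef_add_smul hρ.1 hX] with t ht
  exact ⟨ht, by rw [trace_add, trace_smul, htr, smul_zero, add_zero, hρ.2]⟩

namespace Measurement

variable {d : ℕ} {Ω : Type*} [MeasurableSpace Ω] {M : Measurement d Ω} {σ X : Op d}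

theorem IsIC.eq_zero_of_isHermitian (hM : M.IsIC) (hσ : IsFullRankState σ) (hX : X.IsHermitian)
    (h : ∀ᵐ ξ ∂M.ref, (M.op ξ * X).trace = 0) : X = 0 := by
  have trace_eq : X.trace = 0 := (M.integral_trace_op_mul X).symm.trans (integral_eq_zero_of_ae h)
  obtain ⟨t, state, ht0⟩ : ∃ t : ℝ, IsState (σ + t • X) ∧ t ≠ 0 :=
    (((hσ.eventually_isState_add_smul hX trace_eq).filter_mono nhdsWithin_le_nhds).and
      (self_mem_nhdsWithin (s := {0}ᶜ))).exists
  have h0 : t • X = 0 := left_eq_add.mp <| hM _ _ hσ.isState state <| by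
    filter_upwards [h] with ξ hξ
    rw [prob, prob, Matrix.mul_add, Matrix.mul_smul, trace_add, trace_smul, hξ, smul_zero, add_zero]
  exact (smul_eq_zero.mp h0).resolve_left ht0

theorem IsIC.eq_zero (hM : M.IsIC) (hσ : IsFullRankState σ)
    (h : ∀ᵐ ξ ∂M.ref, (M.op ξ * X).trace = 0) : X = 0 := by
  have h' : ∀ᵐ ξ ∂M.ref, (M.op ξ * star X).trace = 0 := by
    filter_upwards [h] with ξ hξ
    rw [trace_mul_comm, ← (M.posSemidef ξ).isHermitian.eq, star_eq_conjTranspose,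
      ← conjTranspose_mul, trace_conjTranspose, hξ, star_zero]
  have re_eq : (realPart X : Op d) = 0 := hM.eq_zero_of_isHermitian hσ (realPart X).2 <| by
    filter_upwards [h, h'] with ξ hξ hξ'
    rw [realPart_apply_coe, Matrix.mul_smul, Matrix.mul_add, trace_smul, trace_add, hξ, hξ',
      add_zero, smul_zero]
  have im_eq : (imaginaryPart X : Op d) = 0 :=
    hM.eq_zero_of_isHermitian hσ (imaginaryPart X).2 <| by
    filter_upwards [h, h'] with ξ hξ hξ'
    rw [imaginaryPart_apply_coe, Matrix.mul_smul, Matrix.mul_smul, Matrix.mul_sub, trace_smul,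
      trace_smul, trace_sub, hξ, hξ', sub_zero, smul_zero, smul_zero]
  rw [← realPart_add_I_smul_imaginaryPart X, re_eq, im_eq, smul_zero, add_zero]

theorem IsIC.posDef_frame (hM : M.IsIC) (hσ : IsFullRankState σ) : (M.frame σ).PosDef := by
  refine .of_dotProduct_mulVec_pos (M.frame_isHermitian σ) fun x hx => ?_
  obtain ⟨X, rfl⟩ := vec_bijective.surjective x
  have form_nonneg ξ := fisherForm_nonneg hσ.1.posSemidef X (M.posSemidef ξ)
  rw [M.star_vec_dotProduct_frame_mulVec hσ.1, Complex.zero_lt_real]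
  refine (integral_nonneg form_nonneg).lt_of_ne' fun h0 => hx (vec_eq_zero_iff.mpr ?_)
  refine hM.eq_zero hσ ?_
  filter_upwards [(integral_eq_zero_iff_of_nonneg form_nonneg
    (M.integrable_fisherForm hσ.1 X)).mp h0] with ξ hξ
  rcases eq_or_ne (M.op ξ) 0 with hξ0 | hξ0
  · rw [hξ0, Matrix.zero_mul, trace_zero]
  · have prob_ne_zero := (re_trace_mul_pos hσ.1 (M.posSemidef ξ) hξ0).ne'
    simpa only [fisherForm, Pi.zero_apply, div_eq_zero_iff, prob_ne_zero, or_false,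
      pow_eq_zero_iff two_ne_zero, norm_eq_zero] using hξ

end Measurement

/-! ### The scaled MSE matrix -/

section MSE

variable {d : ℕ} {σ : Op d}

theorem mul_frameKernel_mul_conjTranspose {A Y : Op d} {T : SuperOp d}
    (h : T *ᵥ A.vec = ((A * σ).trace.re : ℂ) • Y.vec) :
    T * frameKernel σ A * Tᴴ = ((A * σ).trace.re : ℂ) • ketBra Y Y := by
  have ketBra_eq : T * ketBra A A * Tᴴ = vecMulVec (T *ᵥ A.vec) (star (T *ᵥ A.vec)) := by
    rw [ketBra, mul_vecMulVec, vecMulVec_mul, star_mulVec]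
  set p := (A * σ).trace.re with hp
  rw [frameKernel, ← hp, Matrix.mul_smul, Matrix.smul_mul, ketBra_eq, h, star_smul,
    Complex.star_def, Complex.conj_ofReal, vecMulVec_smul, smul_vecMulVec, ketBra]
  rcases eq_or_ne p 0 with hp0 | hp0
  · rw [hp0, Complex.ofReal_zero, _root_.inv_zero, zero_smul, zero_smul]
  · rw [inv_smul_smul₀ (Complex.ofReal_ne_zero.mpr hp0)]

end MSE

namespace Measurement

variable {d : ℕ} {Ω : Type*} [MeasurableSpace Ω] {M : Measurement d Ω} {σ : Op d}

theorem IsIC.isUnit_det_frame (hM : M.IsIC) (hσ : IsFullRankState σ) : IsUnit (M.frame σ).det :=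
  (isUnit_iff_isUnit_det _).mp (hM.posDef_frame hσ).isUnit

theorem IsIC.frame_inv_mulVec_one (hM : M.IsIC) (hσ : IsFullRankState σ) :
    (M.frame σ)⁻¹ *ᵥ (1 : Op d).vec = σ.vec := by
  rw [← M.frame_mulVec_state hσ.1, mulVec_mulVec, nonsing_inv_mul _ (hM.isUnit_det_frame hσ),
    one_mulVec]

theorem prob_smul_vec_optRec (M : Measurement d Ω) (hσ : σ.PosDef) (ξ : Ω) :
    (M.prob σ ξ : ℂ) • (M.optRec σ ξ).vec = (M.frame σ)⁻¹ *ᵥ (M.op ξ).vec := by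
  have vec_eq : (M.optRec σ ξ).vec = (M.prob σ ξ : ℂ)⁻¹ • ((M.frame σ)⁻¹ *ᵥ (M.op ξ).vec) := rfl
  rw [vec_eq]
  rcases eq_or_ne (M.op ξ) 0 with h0 | h0
  · rw [h0, vec_zero, mulVec_zero, smul_zero, smul_zero]
  · refine smul_inv_smul₀ (Complex.ofReal_ne_zero.mpr ?_) _
    exact (re_trace_mul_pos hσ (M.posSemidef ξ) h0).ne'

theorem IsIC.optMSEMatrix_eq (hM : M.IsIC) (hσ : IsFullRankState σ) :
    M.optMSEMatrix σ = (M.frame σ)⁻¹ - ketBra σ σ := by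
  have hinv : ((M.frame σ)⁻¹)ᴴ = (M.frame σ)⁻¹ := (M.frame_isHermitian σ).inv.eq
  have h := (M.hasMatIntegral_frameKernel hσ.1).map
    (mulRightLinearMap _ ℂ ((M.frame σ)⁻¹)ᴴ ∘ₗ mulLeftLinearMap _ ℂ (M.frame σ)⁻¹)
  simp only [LinearMap.comp_apply, mulLeftLinearMap_apply, mulRightLinearMap_apply,
    mul_frameKernel_mul_conjTranspose (M.prob_smul_vec_optRec hσ.1 _).symm] at h
  rw [nonsing_inv_mul _ (hM.isUnit_det_frame hσ), Matrix.one_mul, hinv] at h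
  exact congrArg (· - ketBra σ σ) (Matrix.ext h.integral_eq)

theorem IsIC.isHermitian_optMSEMatrix (hM : M.IsIC) (hσ : IsFullRankState σ) :
    (M.optMSEMatrix σ).IsHermitian := by
  rw [hM.optMSEMatrix_eq hσ]
  exact (M.frame_isHermitian σ).inv.sub (conjTranspose_ketBra σ σ)

theorem IsIC.optMSEMatrix_mulVec_one (hM : M.IsIC) (hσ : IsFullRankState σ) :
    M.optMSEMatrix σ *ᵥ (1 : Op d).vec = 0 := by
  rw [hM.optMSEMatrix_eq hσ, sub_mulVec, hM.frame_inv_mulVec_one hσ, ketBra_mulVec,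
    star_vec_dotProduct_vec, Matrix.mul_one, hσ.1.isHermitian.eq, hσ.2, one_smul, sub_self]

theorem IsIC.optMSEMatrix_mul_frame_mul (hM : M.IsIC) (hσ : IsFullRankState σ) :
    M.optMSEMatrix σ * M.frame σ * M.optMSEMatrix σ = M.optMSEMatrix σ := by
  have frame_mul : M.frame σ * M.optMSEMatrix σ = 1 - ketBra 1 σ := by
    rw [hM.optMSEMatrix_eq hσ, Matrix.mul_sub, mul_nonsing_inv _ (hM.isUnit_det_frame hσ), ketBra,
      mul_vecMulVec, M.frame_mulVec_state hσ.1, ketBra]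
  have mul_ketBra : M.optMSEMatrix σ * ketBra 1 σ = 0 := by
    rw [ketBra, mul_vecMulVec, hM.optMSEMatrix_mulVec_one hσ, zero_vecMulVec]
  rw [Matrix.mul_assoc, frame_mul, Matrix.mul_sub, Matrix.mul_one, mul_ketBra, sub_zero]

theorem IsIC.optMSEMatrix_mulVec_op (hM : M.IsIC) (hσ : IsFullRankState σ) (ξ : Ω) :
    M.optMSEMatrix σ *ᵥ (M.op ξ).vec = (M.prob σ ξ : ℂ) • (M.optRec σ ξ - σ).vec := by
  have prob_eq : star σ.vec ⬝ᵥ (M.op ξ).vec = M.prob σ ξ := by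
    rw [star_vec_dotProduct_vec, hσ.1.isHermitian.eq, trace_mul_comm, prob,
      ofReal_re_trace_mul (M.posSemidef ξ).isHermitian hσ.1.isHermitian]
  rw [hM.optMSEMatrix_eq hσ, sub_mulVec, ketBra_mulVec, prob_eq, vec_sub, smul_sub,
    M.prob_smul_vec_optRec hσ.1]

theorem IsIC.hasMatIntegral_optMSEMatrix (hM : M.IsIC) (hσ : IsFullRankState σ) :
    HasMatIntegral M.ref
      (fun ξ => (M.prob σ ξ : ℂ) • ketBra (M.optRec σ ξ - σ) (M.optRec σ ξ - σ))
      (M.optMSEMatrix σ) := by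
  have h := (M.hasMatIntegral_frameKernel hσ.1).map
    (mulRightLinearMap _ ℂ (M.optMSEMatrix σ)ᴴ ∘ₗ mulLeftLinearMap _ ℂ (M.optMSEMatrix σ))
  simp only [LinearMap.comp_apply, mulLeftLinearMap_apply, mulRightLinearMap_apply,
    mul_frameKernel_mul_conjTranspose (hM.optMSEMatrix_mulVec_op hσ _)] at h
  rwa [(hM.isHermitian_optMSEMatrix hσ).eq, hM.optMSEMatrix_mul_frame_mul hσ] at h

theorem IsIC.isHermitian_optRec (hM : M.IsIC) (hσ : IsFullRankState σ) (ξ : Ω) :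
    (M.optRec σ ξ).IsHermitian := by
  have hF := hM.isUnit_det_frame hσ
  have vec_eq : (M.optRec σ ξ).vec = (M.prob σ ξ : ℂ)⁻¹ • ((M.frame σ)⁻¹ *ᵥ (M.op ξ).vec) := rfl
  have frame_mulVec : M.frame σ *ᵥ (M.optRec σ ξ).vec = ((M.prob σ ξ : ℂ)⁻¹ • M.op ξ).vec := by
    rw [vec_eq, mulVec_smul, mulVec_mulVec, mul_nonsing_inv _ hF, one_mulVec, vec_smul]
  have frame_mulVec_star := M.frame_mulVec_conjTranspose frame_mulVec
  rw [conjTranspose_smul, (M.posSemidef ξ).isHermitian.eq, star_inv₀, Complex.star_def,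
    Complex.conj_ofReal, ← frame_mulVec] at frame_mulVec_star
  exact vec_inj.mp (mulVec_injective_of_isUnit ((isUnit_iff_isUnit_det _).mpr hF) frame_mulVec_star)

theorem IsIC.prob_smul_trace_optRec_sub (hM : M.IsIC) (hσ : IsFullRankState σ) (ξ : Ω) :
    (M.prob σ ξ : ℂ) • (M.optRec σ ξ - σ).trace = 0 := by
  rw [← star_one_vec_dotProduct, ← dotProduct_smul, ← hM.optMSEMatrix_mulVec_op hσ,
    dotProduct_mulVec, ← (hM.isHermitian_optMSEMatrix hσ).eq, ← star_mulVec,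
    hM.optMSEMatrix_mulVec_one hσ, star_zero, zero_dotProduct]

/-- The errors `Θ_ξ - σ` of the estimator are Hermitian and traceless, so that the WMSE only sees
the weighting matrix on these operators. -/
theorem IsIC.re_trace_mul_optMSEMatrix_congr (hM : M.IsIC) (hσ : IsFullRankState σ)
    {W W' : SuperOp d}
    (h : ∀ X : Op d, X.IsHermitian → X.trace = 0 → quadForm W X = quadForm W' X) :
    (W * M.optMSEMatrix σ).trace.re = (W' * M.optMSEMatrix σ).trace.re := by
  have trace_eq (S : SuperOp d) (ξ : Ω) :
      (S * ((M.prob σ ξ : ℂ) • ketBra (M.optRec σ ξ - σ) (M.optRec σ ξ - σ))).trace.re =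
        M.prob σ ξ * quadForm S (M.optRec σ ξ - σ) := by
    rw [Matrix.mul_smul, trace_smul, ketBra, mul_vecMulVec, trace_vecMulVec, dotProduct_comm,
      smul_eq_mul, Complex.re_ofReal_mul, quadForm]
  have re_trace_eq (S : SuperOp d) : (S * M.optMSEMatrix σ).trace.re =
      ∫ ξ, M.prob σ ξ * quadForm S (M.optRec σ ξ - σ) ∂M.ref := by
    have hC := hM.hasMatIntegral_optMSEMatrix hσ
    rw [← hC.integral_trace_mul S]
    simp only [← trace_eq]
    exact (integral_re (hC.integrable_trace_mul S)).symm
  rw [re_trace_eq, re_trace_eq]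
  congr 1 with ξ
  rcases eq_or_ne (M.prob σ ξ) 0 with h0 | h0
  · rw [h0, zero_mul, zero_mul]
  · rw [h _ ((hM.isHermitian_optRec hσ ξ).sub hσ.1.isHermitian)]
    exact (smul_eq_zero.mp (hM.prob_smul_trace_optRec_sub hσ ξ)).resolve_left
      (Complex.ofReal_ne_zero.mpr h0)

end Measurement

/-! ### The volume of the uncertainty ellipsoid -/

theorem sum_apply_diag {d : ℕ} (v : Fin d × Fin d → ℂ) :
    ∑ i : Fin d, v (i, i) = star (1 : Op d).vec ⬝ᵥ v := by
  obtain ⟨X, rfl⟩ := vec_bijective.surjective v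
  exact (star_one_vec_dotProduct X).symm

theorem tracelessProj_apply {d : ℕ} (v : tracelessKets d) : tracelessProj d v = v := by
  obtain ⟨v, hv⟩ := v
  rw [mem_tracelessKets] at hv
  ext i
  simp [tracelessProj, hv]

/-- The superoperator on the right acts as `O` on the traceless operators, and as the identity on
the quotient by them. -/
theorem barDet_eq_det_add_ketBra {d : ℕ} {O : SuperOp d} {A : Op d}
    (hO : star (1 : Op d).vec ᵥ* O = 0) (hA : A.trace = 1) :
    barDet O = (O + ketBra A 1).det := by
  set T := toLin' (O + ketBra A 1)
  have sub_mem v : T v - v ∈ tracelessKets d := by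
    rw [mem_tracelessKets, sum_apply_diag, dotProduct_sub, toLin'_apply, add_mulVec, dotProduct_add,
      dotProduct_mulVec, hO, zero_dotProduct, ketBra_mulVec, dotProduct_smul,
      star_one_vec_dotProduct, hA, smul_eq_mul, mul_one, zero_add, sub_self]
  have le_comap : tracelessKets d ≤ (tracelessKets d).comap T := fun v hv => by
    rw [Submodule.mem_comap, ← sub_add_cancel (T v) v]
    exact add_mem (sub_mem v) hv
  have restrict_eq : T.restrict le_comap =
      tracelessProj d ∘ₗ O.mulVecLin ∘ₗ (tracelessKets d).subtype := by
    ext1 v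
    have hv := (mem_tracelessKets _).mp v.2
    have hOv : O *ᵥ v.1 ∈ tracelessKets d := by
      rw [mem_tracelessKets, sum_apply_diag, dotProduct_mulVec, hO, zero_dotProduct]
    have hT : T v = O *ᵥ v.1 := by
      rw [toLin'_apply, add_mulVec, ketBra_mulVec, ← sum_apply_diag, hv, zero_smul, add_zero]
    exact Subtype.ext hT |>.trans (tracelessProj_apply ⟨_, hOv⟩).symm
  have mapQ_eq : (tracelessKets d).mapQ _ T le_comap = LinearMap.id :=
    Submodule.linearMap_qext _ <| LinearMap.ext fun v => (Submodule.Quotient.eq _).mpr (sub_mem v)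
  rw [← LinearMap.det_toLin', LinearMap.det_eq_det_mul_det _ T le_comap, mapQ_eq, restrict_eq,
    LinearMap.det_id, mul_one, barDet]

theorem det_one_add_ketBra {d : ℕ} (A B : Op d) :
    (1 + ketBra A B).det = 1 + star B.vec ⬝ᵥ A.vec := by
  rw [ketBra, vecMulVec_eq Unit, det_one_add_replicateCol_mul_replicateRow]

namespace Measurement

variable {d : ℕ} {Ω : Type*} [MeasurableSpace Ω] {M : Measurement d Ω} {σ : Op d}

theorem IsIC.barDet_optMSEMatrix (hM : M.IsIC) (hσ : IsFullRankState σ) :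
    barDet (M.optMSEMatrix σ) = d * ((M.frame σ).det)⁻¹ := by
  have hC : star (1 : Op d).vec ᵥ* M.optMSEMatrix σ = 0 := by
    rw [← (hM.isHermitian_optMSEMatrix hσ).eq, ← star_mulVec, hM.optMSEMatrix_mulVec_one hσ,
      star_zero]
  have factor : M.optMSEMatrix σ + ketBra σ 1 = (M.frame σ)⁻¹ * (1 + ketBra 1 (1 - σ)) := by
    rw [hM.optMSEMatrix_eq hσ, Matrix.mul_add, Matrix.mul_one, ketBra, ketBra, ketBra,
      mul_vecMulVec, hM.frame_inv_mulVec_one hσ, vec_sub, star_sub, vecMulVec_sub]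
    abel
  rw [barDet_eq_det_add_ketBra hC hσ.2, factor, det_mul, det_nonsing_inv, Ring.inverse_eq_inv',
    det_one_add_ketBra, star_dotProduct, star_one_vec_dotProduct, trace_sub, trace_one, hσ.2]
  simp [mul_comm]

theorem unitBallVol_pos (d : ℕ) : 0 < unitBallVol d :=
  div_pos (Real.rpow_pos_of_pos Real.pi_pos _) (Real.Gamma_pos_of_pos (by positivity))

theorem IsIC.log_volume (hM : M.IsIC) (hσ : IsFullRankState σ) :
    Real.log (M.volume σ) =
      Real.log (unitBallVol d) + (Real.log d - Real.log (M.frame σ).det.re) / 2 := by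
  have hd : (0 : ℝ) < d := by
    have := hσ.neZero
    exact_mod_cast NeZero.pos d
  have hdet : 0 < (M.frame σ).det.re := re_det_pos (hM.posDef_frame hσ)
  have hbar : (barDet (M.optMSEMatrix σ)).re = d * ((M.frame σ).det.re)⁻¹ := by
    have h := hM.barDet_optMSEMatrix hσ
    rw [← ofReal_re_det (M.frame_isHermitian σ)] at h
    rw [h, RCLike.ofReal_eq_complex_ofReal, ← Complex.ofReal_natCast, ← Complex.ofReal_inv,
      ← Complex.ofReal_mul, Complex.ofReal_re, RCLike.re_eq_complex_re]
  rw [volume, hbar, Real.log_mul (unitBallVol_pos d).ne' (by positivity),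
    Real.log_sqrt (by positivity), Real.log_mul hd.ne' (by positivity), Real.log_inv]
  ring

end Measurement

/-! ### The orbit of a state -/

section ConjSuperOp

variable {d : ℕ}

/-- The superoperator `A ↦ V A V†`. -/
def conjSuperOp (V : U d) : SuperOp d := (V : Op d).map star ⊗ₖ (V : Op d)

theorem conjSuperOp_mulVec_vec (V : U d) (A : Op d) :
    conjSuperOp V *ᵥ A.vec = (conj V A).vec := by
  rw [conjSuperOp, kronecker_mulVec_vec]
  rfl

theorem conjTranspose_conjSuperOp (V : U d) : (conjSuperOp V)ᴴ = conjSuperOp V⁻¹ := by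
  rw [conjSuperOp, conjTranspose_kronecker]
  rfl

theorem conjSuperOp_inv_mul_self (V : U d) : conjSuperOp V⁻¹ * conjSuperOp V = 1 := by
  rw [← mulVec_injective.eq_iff]
  ext1 v
  obtain ⟨A, rfl⟩ := vec_bijective.surjective v
  rw [← mulVec_mulVec, conjSuperOp_mulVec_vec, conjSuperOp_mulVec_vec, conj_inv_conj, one_mulVec]

theorem conjSuperOp_mul_inv_self (V : U d) : conjSuperOp V * conjSuperOp V⁻¹ = 1 :=
  mul_eq_one_comm.mp (conjSuperOp_inv_mul_self V)

theorem star_vec_vecMul_conjSuperOp_inv (V : U d) (A : Op d) :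
    star A.vec ᵥ* conjSuperOp V⁻¹ = star (conj V A).vec := by
  rw [← conjTranspose_conjSuperOp, ← star_mulVec, conjSuperOp_mulVec_vec]

theorem conjSuperOp_inv_mul_ketBra_mul (V : U d) (A B : Op d) :
    conjSuperOp V⁻¹ * ketBra (conj V A) (conj V B) * conjSuperOp V = ketBra A B := by
  have h := star_vec_vecMul_conjSuperOp_inv V⁻¹ (conj V B)
  rw [inv_inv, conj_inv_conj] at h
  rw [ketBra, mul_vecMulVec, vecMulVec_mul, conjSuperOp_mulVec_vec, conj_inv_conj, h, ketBra]

theorem continuous_conjSuperOp : Continuous fun V : U d => conjSuperOp V :=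
  continuous_matrix fun _ _ => (continuous_star.comp (continuous_subtype_val.matrix_elem _ _)).mul
    (continuous_subtype_val.matrix_elem _ _)

end ConjSuperOp

namespace Measurement

variable {d : ℕ} {Ω : Type*} [MeasurableSpace Ω] (M : Measurement d Ω) {ρ : Op d}

/-- The frame superoperator at the state `V ρ V†`, transported back to `ρ`. -/
def orbitFrame (ρ : Op d) (V : U d) : SuperOp d :=
  conjSuperOp V⁻¹ * M.frame (conj V ρ) * conjSuperOp V

theorem orbitFrame_one (ρ : Op d) : M.orbitFrame ρ 1 = M.frame ρ := by
  have h : conjSuperOp (1 : U d) = 1 := by simp [conjSuperOp]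
  rw [orbitFrame, inv_one, h, Matrix.one_mul, Matrix.mul_one, conj_one]

theorem orbitFrame_isHermitian (ρ : Op d) (V : U d) : (M.orbitFrame ρ V).IsHermitian := by
  rw [orbitFrame, ← conjTranspose_conjSuperOp]
  exact isHermitian_conjTranspose_mul_mul _ (M.frame_isHermitian _)

theorem det_orbitFrame (ρ : Op d) (V : U d) :
    (M.orbitFrame ρ V).det = (M.frame (conj V ρ)).det := by
  rw [orbitFrame, det_mul, det_mul, mul_right_comm, ← det_mul, conjSuperOp_inv_mul_self, det_one,
    one_mul]

theorem orbitFrame_inv (ρ : Op d) (V : U d) :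
    (M.orbitFrame ρ V)⁻¹ = conjSuperOp V⁻¹ * (M.frame (conj V ρ))⁻¹ * conjSuperOp V := by
  rw [orbitFrame, Matrix.mul_inv_rev, Matrix.mul_inv_rev,
    inv_eq_right_inv (conjSuperOp_mul_inv_self V), inv_eq_right_inv (conjSuperOp_inv_mul_self V),
    Matrix.mul_assoc]

theorem continuous_orbitFrame (hρ : ρ.PosDef) : Continuous (M.orbitFrame ρ) :=
  ((continuous_conjSuperOp.comp continuous_inv).matrix_mul
    (M.continuous_frame_conj hρ)).matrix_mul continuous_conjSuperOp

theorem star_vec_dotProduct_orbitFrame_mulVec (hρ : ρ.PosDef) (V : U d) (X : Op d) :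
    star X.vec ⬝ᵥ (M.orbitFrame ρ V *ᵥ X.vec) =
      ((∫ ξ, fisherForm ρ X (conj V⁻¹ (M.op ξ)) ∂M.ref : ℝ) : ℂ) := by
  simp only [← fisherForm_conj]
  rw [← M.star_vec_dotProduct_frame_mulVec (posDef_conj V hρ), orbitFrame, ← mulVec_mulVec,
    ← mulVec_mulVec, dotProduct_mulVec, star_vec_vecMul_conjSuperOp_inv, conjSuperOp_mulVec_vec]

/-- The Haar average of `M.orbitFrame ρ` (entrywise). -/
def averageOrbitFrame (ρ : Op d) : SuperOp d :=
  Matrix.of fun i j => ∫ V, M.orbitFrame ρ V i j ∂haarU d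

theorem hasMatIntegral_orbitFrame (hρ : ρ.PosDef) :
    HasMatIntegral (haarU d) (M.orbitFrame ρ) (M.averageOrbitFrame ρ) where
  integrable i j := ((M.continuous_orbitFrame hρ).matrix_elem i j).integrable_of_hasCompactSupport
    (.of_compactSpace _)
  integral_eq _ _ := rfl

theorem averageOrbitFrame_isHermitian (ρ : Op d) : (M.averageOrbitFrame ρ).IsHermitian :=
  .ext fun i j => by
    change star (∫ V, M.orbitFrame ρ V j i ∂haarU d) = ∫ V, M.orbitFrame ρ V i j ∂haarU d
    simp only [← (M.orbitFrame_isHermitian ρ _).apply i j, ← starRingEnd_apply,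
      ← _root_.integral_conj]

theorem IsIC.posDef_orbitFrame {M : Measurement d Ω} (hM : M.IsIC) (hρ : IsFullRankState ρ)
    (V : U d) : (M.orbitFrame ρ V).PosDef := by
  rw [orbitFrame, ← conjTranspose_conjSuperOp]
  exact (hM.posDef_frame (hρ.conj V)).conjTranspose_mul_mul_same
    (mulVec_injective_of_isUnit (.of_mul_eq_one _ (conjSuperOp_mul_inv_self V)))

theorem IsIC.integrable_re_trace_mul_inv_orbitFrame {M : Measurement d Ω} (hM : M.IsIC)
    (hρ : IsFullRankState ρ) (S : SuperOp d) :
    Integrable (fun V => (S * (M.orbitFrame ρ V)⁻¹).trace.re) (haarU d) := by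
  have hc := M.continuous_orbitFrame hρ.1
  have continuous_inv : Continuous fun V => (M.orbitFrame ρ V)⁻¹ := by
    simp only [inv_def, Ring.inverse_eq_inv']
    exact (hc.matrix_det.inv₀ fun V => (hM.posDef_orbitFrame hρ V).det_pos.ne').smul
      hc.matrix_adjugate
  exact integrable_haarU
    (Complex.continuous_re.comp (continuous_const.matrix_mul continuous_inv).matrix_trace)

theorem IsIC.integrable_log_re_det_orbitFrame {M : Measurement d Ω} (hM : M.IsIC)
    (hρ : IsFullRankState ρ) :
    Integrable (fun V => Real.log (M.orbitFrame ρ V).det.re) (haarU d) :=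
  integrable_haarU <| (Complex.continuous_re.comp (M.continuous_orbitFrame hρ.1).matrix_det).log
    fun V => (re_det_pos (hM.posDef_orbitFrame hρ V)).ne'

theorem aestronglyMeasurable_fisherForm_conj_inv {ν : Measure Ω} (hν : ν ≪ M.ref)
    (ρ X : Op d) : AEStronglyMeasurable
      (Function.uncurry fun (V : U d) ξ => fisherForm ρ X (conj V⁻¹ (M.op ξ)))
      ((haarU d).prod ν) := by
  have measurable_trace (Y : Op d) : AEMeasurable
      (fun p : U d × Ω => (M.op p.2 * conj p.1 Y).trace) ((haarU d).prod ν) := by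
    simp only [trace, diag, Matrix.mul_apply]
    exact (Finset.aestronglyMeasurable_fun_sum _ fun i _ =>
      Finset.aestronglyMeasurable_fun_sum _ fun j _ =>
        ((M.integrable i j).aestronglyMeasurable.mono_ac hν).comp_snd.mul
          ((continuous_conj Y).matrix_elem j i).aestronglyMeasurable.comp_fst).aemeasurable
  simp only [← fisherForm_conj]
  exact (((measurable_trace X).norm.pow_const 2).div
    (Complex.measurable_re.comp_aemeasurable (measurable_trace ρ))).aestronglyMeasurable

/-- Twirling replaces the outcome operator `A` by a combination of the pure states `V |0⟩⟨0| V†`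
of total weight `tr A`, and the Fisher information does not decrease. -/
theorem integral_integral_fisherForm_conj_inv_le [NeZero d] (hρ : ρ.PosDef) (X : Op d) :
    ∫ V, ∫ ξ, fisherForm ρ X (conj V⁻¹ (M.op ξ)) ∂M.ref ∂haarU d ≤
      d * ∫ V, fisherForm ρ X (conj V (single 0 0 1)) ∂haarU d := by
  open scoped Matrix.Norms.Frobenius in
  obtain ⟨c, hc, hρc⟩ := exists_pos_sub_smul_one_posSemidef hρ
  have form_nonneg (V : U d) ξ : 0 ≤ fisherForm ρ X (conj V⁻¹ (M.op ξ)) :=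
    fisherForm_nonneg hρ.posSemidef X (posSemidef_conj _ (M.posSemidef ξ))
  have form_le (V : U d) ξ :
      ‖fisherForm ρ X (conj V⁻¹ (M.op ξ))‖ ≤ ‖X‖ ^ 2 / c * (M.op ξ).trace.re := by
    rw [Real.norm_of_nonneg (form_nonneg V ξ), ← trace_conj V⁻¹ (M.op ξ)]
    exact fisherForm_le hc hρc X (posSemidef_conj _ (M.posSemidef ξ))
  have hg := M.integrable_re_trace_op.const_mul (‖X‖ ^ 2 / c)
  have := isFiniteMeasure_withDensity_ofReal hg.hasFiniteIntegral
  calc ∫ V, ∫ ξ, fisherForm ρ X (conj V⁻¹ (M.op ξ)) ∂M.ref ∂haarU d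
      = ∫ ξ, ∫ V, fisherForm ρ X (conj V⁻¹ (M.op ξ)) ∂haarU d ∂M.ref :=
        integral_integral_swap_of_norm_le hg (M.aestronglyMeasurable_fisherForm_conj_inv
          (withDensity_absolutelyContinuous _ _) ρ X) form_le
    _ ≤ ∫ ξ, (M.op ξ).trace.re * ∫ V, fisherForm ρ X (conj V (single 0 0 1)) ∂haarU d ∂M.ref :=
        integral_mono_of_nonneg
          (.of_forall fun ξ => integral_nonneg fun V => form_nonneg V ξ)
          (M.integrable_re_trace_op.mul_const _)
          (.of_forall fun ξ => integral_fisherForm_conj_le hρ X (M.posSemidef ξ))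
    _ = d * ∫ V, fisherForm ρ X (conj V (single 0 0 1)) ∂haarU d := by
        rw [integral_mul_const, M.integral_re_trace_op]

end Measurement

/-! ### The covariant measurement -/

section Covariant

variable {d : ℕ} [NeZero d] {ρ : Op d}

theorem star_vec_dotProduct_covariant_orbitFrame_mulVec (hρ : ρ.PosDef) (V : U d) (X : Op d) :
    star X.vec ⬝ᵥ ((covariant d).orbitFrame ρ V *ᵥ X.vec) =
      ((d * ∫ V', fisherForm ρ X (conj V' (single 0 0 1)) ∂haarU d : ℝ) : ℂ) := by
  have hmeas : AEStronglyMeasurable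
      (fun P => fisherForm ρ X (conj V⁻¹ ((covariant d).op P))) (haarPure d) := by
    simp only [← fisherForm_conj]
    exact ((covariant d).integrable_fisherForm (posDef_conj V hρ) _).aestronglyMeasurable
  have op_pureOrbit (V' : U d) : fisherForm ρ X (conj V⁻¹ ((covariant d).op (pureOrbit d V'))) =
      d * fisherForm ρ X (conj (V⁻¹ * V') (single 0 0 1)) := by
    rw [conj_mul, ← fisherForm_smul, ← Complex.coe_smul, ← conj_smul]
    rfl
  rw [(covariant d).star_vec_dotProduct_orbitFrame_mulVec hρ]
  change ((∫ P, _ ∂(haarU d).map (pureOrbit d) : ℝ) : ℂ) = _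
  rw [integral_map (continuous_pureOrbit d).measurable.aemeasurable hmeas]
  simp only [op_pureOrbit]
  rw [integral_const_mul,
    integral_mul_left_eq_self (fun V' => fisherForm ρ X (conj V' (single 0 0 1))) V⁻¹]

theorem covariant_orbitFrame (hρ : ρ.PosDef) (V : U d) :
    (covariant d).orbitFrame ρ V = (covariant d).frame ρ := by
  rw [← (covariant d).orbitFrame_one]
  refine eq_of_forall_star_dotProduct_mulVec_eq ((covariant d).orbitFrame_isHermitian ρ V)
    ((covariant d).orbitFrame_isHermitian ρ 1) fun x => ?_
  obtain ⟨X, rfl⟩ := vec_bijective.surjective x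
  rw [star_vec_dotProduct_covariant_orbitFrame_mulVec hρ,
    star_vec_dotProduct_covariant_orbitFrame_mulVec hρ]

theorem eq_zero_of_forall_re_trace_conj_mul_eq_zero {X : Op d} (hX : X.IsHermitian)
    (h : ∀ V : U d, (conj V (single 0 0 1) * X).trace.re = 0) : X = 0 := by
  obtain ⟨W, hW⟩ := exists_eq_sum_eigenvalues_smul_conj hX
  have overlap_eq_zero k : (conj (W k) (single 0 0 1) * X).trace = 0 := by
    rw [← ofReal_re_trace_mul (posSemidef_conj _ (posSemidef_single_zero d)).isHermitian hX, h,
      Complex.ofReal_zero]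
  refine trace_conjTranspose_mul_self_eq_zero_iff.mp ?_
  rw [hX.eq]
  nth_rw 1 [hW]
  simp only [Finset.sum_mul, trace_sum, Matrix.smul_mul, trace_smul, overlap_eq_zero, smul_zero,
    Finset.sum_const_zero]

theorem covariant_isIC : (covariant d).IsIC := by
  intro ρ σ hρ hσ hp
  have overlap_op (V : U d) (Y : Op d) : (covariant d).prob Y (pureOrbit d V) =
      d * (conj V (single 0 0 1) * Y).trace.re := by
    change ((d : ℂ) • conj V (single 0 0 1) * Y).trace.re = _
    rw [Matrix.smul_mul, trace_smul, smul_eq_mul, ← Complex.ofReal_natCast, Complex.re_ofReal_mul]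
  have hae : ∀ᵐ V ∂haarU d, (conj V (single 0 0 1) * (ρ - σ)).trace.re = 0 := by
    filter_upwards [ae_of_ae_map (continuous_pureOrbit d).measurable.aemeasurable hp] with V hV
    rw [overlap_op, overlap_op] at hV
    rw [Matrix.mul_sub, trace_sub, Complex.sub_re, sub_eq_zero]
    exact mul_left_cancel₀ (Nat.cast_ne_zero.mpr (NeZero.ne d)) hV
  have hc : Continuous fun V : U d => (conj V (single 0 0 1) * (ρ - σ)).trace.re :=
    Complex.continuous_re.comp ((continuous_conj _).matrix_mul continuous_const).matrix_trace
  exact sub_eq_zero.mp <| eq_zero_of_forall_re_trace_conj_mul_eq_zero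
    (hρ.1.isHermitian.sub hσ.1.isHermitian)
    (congrFun ((hc.ae_eq_iff_eq (haarU d) continuous_const).mp hae))

theorem posSemidef_covariant_frame_sub_averageOrbitFrame {Ω : Type*} [MeasurableSpace Ω]
    (M : Measurement d Ω) (hρ : ρ.PosDef) :
    ((covariant d).frame ρ - M.averageOrbitFrame ρ).PosSemidef := by
  refine .of_dotProduct_mulVec_nonneg
    (((covariant d).frame_isHermitian ρ).sub (M.averageOrbitFrame_isHermitian ρ)) fun x => ?_
  obtain ⟨X, rfl⟩ := vec_bijective.surjective x
  rw [sub_mulVec, dotProduct_sub, ← (covariant d).orbitFrame_one,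
    star_vec_dotProduct_covariant_orbitFrame_mulVec hρ,
    ← (M.hasMatIntegral_orbitFrame hρ).integral_dotProduct_mulVec]
  simp only [M.star_vec_dotProduct_orbitFrame_mulVec hρ]
  rw [integral_complex_ofReal, sub_nonneg, Complex.real_le_real]
  exact M.integral_integral_fisherForm_conj_inv_le hρ X

end Covariant

theorem orbitAverageLE_log_volume {d : ℕ} [NeZero d] {Ω : Type*} [MeasurableSpace Ω]
    {M : Measurement d Ω} (hM : M.IsIC) {ρ : Op d} (hρ : IsFullRankState ρ) :
    OrbitAverageLE (fun σ => Real.log ((covariant d).volume σ))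
      (fun σ => Real.log (M.volume σ)) ρ := by
  have log_volume_conj (V : U d) : Real.log (M.volume (conj V ρ)) = Real.log (unitBallVol d) +
      (Real.log d - Real.log (M.orbitFrame ρ V).det.re) / 2 := by
    rw [hM.log_volume (hρ.conj V), M.det_orbitFrame]
  have log_volume_covariant (V : U d) : Real.log ((covariant d).volume (conj V ρ)) =
      Real.log (unitBallVol d) + (Real.log d - Real.log ((covariant d).frame ρ).det.re) / 2 := by
    rw [covariant_isIC.log_volume (hρ.conj V), ← (covariant d).det_orbitFrame,
      covariant_orbitFrame hρ.1]
  have log_det_integrable := hM.integrable_log_re_det_orbitFrame hρ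
  have log_det_le : ∫ V, Real.log (M.orbitFrame ρ V).det.re ∂haarU d ≤
      Real.log ((covariant d).frame ρ).det.re :=
    (M.hasMatIntegral_orbitFrame hρ.1).integral_log_re_det_le (hM.posDef_orbitFrame hρ)
      (covariant_isIC.posDef_frame hρ) (posSemidef_covariant_frame_sub_averageOrbitFrame M hρ.1)
      log_det_integrable
  have half_integrable :=
    ((integrable_const (Real.log d) (μ := haarU d)).sub log_det_integrable).div_const 2
  simp only [OrbitAverageLE, orbitAverage, log_volume_conj, log_volume_covariant]
  refine ⟨integrable_const _, (integrable_const _).add half_integrable, ?_⟩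
  simp only [Pi.sub_apply] at half_integrable
  rw [integral_add (integrable_const _) half_integrable, integral_div,
    integral_sub (integrable_const _) log_det_integrable]
  simp only [integral_const, probReal_univ, one_smul]
  linarith

/-! ### Weighting matrices -/

section Weight

variable {d : ℕ} {W : Op d → SuperOp d} {D : Op d → Op d → ℝ} {ρ X : Op d}

theorem quadForm_smul (S : SuperOp d) (t : ℝ) (X : Op d) :
    quadForm S (t • X) = t ^ 2 * quadForm S X := by
  simp only [quadForm, vec_smul, mulVec_smul, star_smul, smul_dotProduct, dotProduct_smul,
    star_trivial, smul_smul, Complex.smul_re, smul_eq_mul, sq]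

theorem trace_conjTranspose_smul_mul_smul (t : ℝ) (X : Op d) :
    ((t • X)ᴴ * (t • X)).trace.re = t ^ 2 * (Xᴴ * X).trace.re := by
  simp only [conjTranspose_smul, star_trivial, Matrix.smul_mul, Matrix.mul_smul, smul_smul,
    trace_smul, Complex.smul_re, smul_eq_mul, sq]

theorem IsWeightOf.tendsto_sq_div_sq (hW : IsWeightOf W D) (hρ : IsFullRankState ρ)
    (hX : X.IsHermitian) (htr : X.trace = 0) :
    Filter.Tendsto (fun t : ℝ => D ρ (ρ + t • X) ^ 2 / t ^ 2) (𝓝[≠] 0)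
      (𝓝 (quadForm (W ρ) X)) := by
  have line_tendsto :
      Filter.Tendsto (fun t : ℝ => ρ + t • X) (𝓝[≠] 0) (𝓝[{σ | IsState σ}] ρ) := by
    refine tendsto_nhdsWithin_iff.mpr
      ⟨.mono_left ?_ nhdsWithin_le_nhds,
        (hρ.eventually_isState_add_smul hX htr).filter_mono nhdsWithin_le_nhds⟩
    exact Continuous.tendsto' (by fun_prop) 0 ρ (by rw [zero_smul, add_zero])
  have remainder := (hW ρ hρ).2.comp_tendsto line_tendsto
  simp only [Function.comp_def, add_sub_cancel_left, quadForm_smul,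
    trace_conjTranspose_smul_mul_smul] at remainder
  have remainder_div := (remainder.trans_isBigO
    (Asymptotics.isBigO_of_le' (c := |(Xᴴ * X).trace.re|) (g := fun t : ℝ => t ^ 2) _ fun t => by
      rw [norm_mul, mul_comm, Real.norm_eq_abs (Xᴴ * X).trace.re])).tendsto_div_nhds_zero
  rw [← zero_add (quadForm (W ρ) X)]
  refine (remainder_div.add_const _).congr' ?_
  filter_upwards [self_mem_nhdsWithin] with t (ht : t ≠ 0)
  field_simp
  ring

theorem IsWeightOf.quadForm_conj (hW : IsWeightOf W D) (hD : UnitarilyInvariant D)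
    (hρ : IsFullRankState ρ) (hX : X.IsHermitian) (htr : X.trace = 0) (V : U d) :
    quadForm (W (conj V ρ)) (conj V X) = quadForm (W ρ) X := by
  have conj_line (t : ℝ) : conj V ρ + t • conj V X = conj V (ρ + t • X) := by
    rw [← Complex.coe_smul, ← conj_smul, Complex.coe_smul, conj_eq_conjStarAlgAut,
      conj_eq_conjStarAlgAut, ← map_add, conj_eq_conjStarAlgAut]
  refine tendsto_nhds_unique
    (hW.tendsto_sq_div_sq (hρ.conj V) (isHermitian_mul_mul_conjTranspose _ hX)
      ((trace_conj V X).trans htr))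
    ((hW.tendsto_sq_div_sq hρ hX htr).congr' ?_)
  filter_upwards [(hρ.eventually_isState_add_smul hX htr).filter_mono nhdsWithin_le_nhds]
    with t ht
  rw [← hD V _ _ hρ.isState ht, ← conj_line]

theorem quadForm_conjSuperOp_mul_mul_inv (S : SuperOp d) (V : U d) (X : Op d) :
    quadForm (conjSuperOp V * S * conjSuperOp V⁻¹) X = quadForm S (conj V⁻¹ X) := by
  have h := star_vec_vecMul_conjSuperOp_inv V⁻¹ X
  rw [inv_inv] at h
  rw [quadForm, quadForm, ← h, ← conjSuperOp_mulVec_vec, ← dotProduct_mulVec, mulVec_mulVec,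
    mulVec_mulVec, Matrix.mul_assoc]

theorem Measurement.IsIC.wmse_conj {Ω : Type*} [MeasurableSpace Ω] {M : Measurement d Ω}
    (hM : M.IsIC) (hW : IsWeightOf W D) (hD : UnitarilyInvariant D) (hρ : IsFullRankState ρ)
    (V : U d) :
    M.wmse W (conj V ρ) =
      (W ρ * (M.orbitFrame ρ V)⁻¹).trace.re - (W ρ * ketBra ρ ρ).trace.re := by
  have weight_congr := hM.re_trace_mul_optMSEMatrix_congr (hρ.conj V) (W := W (conj V ρ))
    (W' := conjSuperOp V * W ρ * conjSuperOp V⁻¹) fun X hX htr => by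
      have hX' : (conj V⁻¹ X).IsHermitian := isHermitian_mul_mul_conjTranspose _ hX
      rw [quadForm_conjSuperOp_mul_mul_inv,
        ← hW.quadForm_conj hD hρ hX' ((trace_conj _ X).trans htr) V, ← conj_mul, mul_inv_cancel,
        conj_one]
  calc M.wmse W (conj V ρ)
      = (W ρ * (conjSuperOp V⁻¹ * M.optMSEMatrix (conj V ρ) * conjSuperOp V)).trace.re := by
        rw [wmse, weight_congr, trace_mul_comm, ← Matrix.mul_assoc, ← Matrix.mul_assoc,
          trace_mul_comm, ← Matrix.mul_assoc, trace_mul_comm]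
        simp only [Matrix.mul_assoc]
    _ = (W ρ * (M.orbitFrame ρ V)⁻¹).trace.re - (W ρ * ketBra ρ ρ).trace.re := by
        rw [hM.optMSEMatrix_eq (hρ.conj V), Matrix.mul_sub, Matrix.sub_mul,
          conjSuperOp_inv_mul_ketBra_mul, ← orbitFrame_inv, Matrix.mul_sub, trace_sub,
          Complex.sub_re]

theorem orbitAverageLE_wmse [NeZero d] {Ω : Type*} [MeasurableSpace Ω] {M : Measurement d Ω}
    (hM : M.IsIC) (hρ : IsFullRankState ρ) (hD : UnitarilyInvariant D) (hW : IsWeightOf W D) :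
    OrbitAverageLE ((covariant d).wmse W) (M.wmse W) ρ := by
  have trace_integrable := hM.integrable_re_trace_mul_inv_orbitFrame hρ (W ρ)
  have trace_le : (W ρ * ((covariant d).frame ρ)⁻¹).trace.re ≤
      ∫ V, (W ρ * (M.orbitFrame ρ V)⁻¹).trace.re ∂haarU d :=
    (M.hasMatIntegral_orbitFrame hρ.1).re_trace_mul_inv_le (hM.posDef_orbitFrame hρ)
      (covariant_isIC.posDef_frame hρ) (posSemidef_covariant_frame_sub_averageOrbitFrame M hρ.1)
      (hW ρ hρ).1 trace_integrable
  simp only [OrbitAverageLE, orbitAverage, covariant_isIC.wmse_conj hW hD hρ,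
    hM.wmse_conj hW hD hρ, covariant_orbitFrame hρ.1]
  refine ⟨integrable_const _, trace_integrable.sub (integrable_const _), ?_⟩
  rw [integral_sub trace_integrable (integrable_const _)]
  simp only [integral_const, probReal_univ, one_smul]
  exact sub_le_sub_right trace_le _

end Weight

/-! ### The Hilbert-Schmidt distance -/

section HilbertSchmidt

variable {d : ℕ}

theorem unitarilyInvariant_hsDist : UnitarilyInvariant (hsDist (d := d)) := by
  intro V ρ σ _ _
  rw [hsDist, hsDist, ← conj_sub, conjTranspose_conj, conj_mul_conj, trace_conj]

theorem isWeightOf_hsWeight : IsWeightOf hsWeight (hsDist (d := d)) := by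
  refine fun ρ _ => ⟨PosSemidef.one, .congr_left (Asymptotics.isLittleO_zero _ _) fun σ => ?_⟩
  have trace_nonneg : 0 ≤ ((ρ - σ)ᴴ * (ρ - σ)).trace.re :=
    (Complex.nonneg_iff.mp (posSemidef_conjTranspose_mul_self (ρ - σ)).trace_nonneg).1
  rw [hsDist, Real.sq_sqrt trace_nonneg, quadForm, hsWeight, one_mulVec, star_vec_dotProduct_vec,
    ← neg_sub σ ρ, conjTranspose_neg, Matrix.neg_mul, Matrix.mul_neg, neg_neg, sub_self]

end HilbertSchmidt

/-! ### The Bures distance -/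

section OpSqrt

variable {d : ℕ} {A : Op d}

open scoped MatrixOrder in
theorem posSemidef_opSqrt (A : Op d) : (opSqrt A).PosSemidef :=
  nonneg_iff_posSemidef.mp (cfc_nonneg fun x _ => Real.sqrt_nonneg x)

open scoped MatrixOrder in
theorem opSqrt_mul_opSqrt (hA : A.PosSemidef) : opSqrt A * opSqrt A = A := by
  have sqrt_mul_sqrt : (spectrum ℝ A).EqOn (fun x => √x * √x) id := fun x hx =>
    Real.mul_self_sqrt (spectrum_nonneg_of_nonneg (nonneg_iff_posSemidef.mpr hA) hx)
  rw [opSqrt, ← cfc_mul Real.sqrt Real.sqrt A Real.continuous_sqrt.continuousOn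
    Real.continuous_sqrt.continuousOn, cfc_congr sqrt_mul_sqrt]
  exact cfc_id ℝ A hA.isHermitian.isSelfAdjoint

theorem opSqrt_mul_inv_mul_opSqrt (hA : A.PosDef) : opSqrt A * A⁻¹ * opSqrt A = 1 := by
  have hr := opSqrt_mul_opSqrt hA.posSemidef
  have hdet : IsUnit (opSqrt A).det :=
    isUnit_of_mul_isUnit_left (by
      rw [← det_mul, hr]
      exact (isUnit_iff_isUnit_det A).mp hA.isUnit)
  nth_rw 2 [← hr]
  rw [Matrix.mul_inv_rev, mul_nonsing_inv_cancel_left _ _ hdet, nonsing_inv_mul _ hdet]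

theorem posSemidef_opSqrt_mul_mul_opSqrt {B : Op d} (hB : B.PosSemidef) (A : Op d) :
    (opSqrt A * B * opSqrt A).PosSemidef := by
  simpa only [(posSemidef_opSqrt A).isHermitian.eq] using
    hB.mul_mul_conjTranspose_same (opSqrt A)

theorem opSqrt_conj (hA : A.IsHermitian) (V : U d) : opSqrt (conj V A) = conj V (opSqrt A) := by
  have hc : Continuous (Unitary.conjStarAlgAut ℂ (Op d) V) :=
    (continuous_const.matrix_mul continuous_id).matrix_mul continuous_const
  exact (StarAlgHomClass.map_cfc (S := ℂ) (Unitary.conjStarAlgAut ℂ (Op d) V) Real.sqrt A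
    Real.continuous_sqrt.continuousOn hc hA.isSelfAdjoint
    (isHermitian_mul_mul_conjTranspose _ hA).isSelfAdjoint).symm

end OpSqrt

section Bures

variable {d : ℕ} {ρ σ X Z : Op d}

theorem unitarilyInvariant_buresDist : UnitarilyInvariant (buresDist (d := d)) := by
  intro V ρ σ hρ hσ
  rw [buresDist, buresDist, opSqrt_conj hρ.1.isHermitian, conj_mul_conj, conj_mul_conj,
    opSqrt_conj (posSemidef_opSqrt_mul_mul_opSqrt hσ.1 ρ).isHermitian, trace_conj]

/-- The superoperator `X ↦ ρ X + X ρ`, whose inverse is twice the Bures weight. -/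
def anticommSuperOp (ρ : Op d) : SuperOp d := (1 : Op d) ⊗ₖ ρ + ρᵀ ⊗ₖ (1 : Op d)

theorem anticommSuperOp_mulVec_vec (ρ Z : Op d) :
    anticommSuperOp ρ *ᵥ Z.vec = (ρ * Z + Z * ρ).vec := by
  simp only [anticommSuperOp, add_mulVec, kronecker_mulVec_vec, transpose_transpose,
    transpose_one, Matrix.one_mul, Matrix.mul_one, vec_add]

theorem posDef_anticommSuperOp (hρ : ρ.PosDef) : (anticommSuperOp ρ).PosDef :=
  (PosDef.one.kronecker hρ).add (hρ.transpose.kronecker PosDef.one)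

theorem buresWeight_eq_smul_inv (ρ : Op d) :
    buresWeight ρ = (1 / 2 : ℂ) • (anticommSuperOp ρ)⁻¹ := rfl

theorem posSemidef_buresWeight (hρ : ρ.PosDef) : (buresWeight ρ).PosSemidef := by
  rw [buresWeight_eq_smul_inv]
  exact (posDef_anticommSuperOp hρ).inv.posSemidef.smul (by positivity)

theorem exists_mul_add_mul_eq (hρ : ρ.PosDef) (X : Op d) : ∃ Z, ρ * Z + Z * ρ = X := by
  obtain ⟨Z, hZ⟩ := vec_bijective.surjective ((anticommSuperOp ρ)⁻¹ *ᵥ X.vec)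
  have hdet := (isUnit_iff_isUnit_det _).mp (posDef_anticommSuperOp hρ).isUnit
  refine ⟨Z, vec_bijective.injective ?_⟩
  rw [← anticommSuperOp_mulVec_vec, hZ, mulVec_mulVec, mul_nonsing_inv _ hdet, one_mulVec]

theorem quadForm_buresWeight (hρ : ρ.PosDef) (hX : X.IsHermitian) (hZ : ρ * Z + Z * ρ = X) :
    quadForm (buresWeight ρ) X = (Z * ρ * Z).trace.re := by
  have hdet := (isUnit_iff_isUnit_det _).mp (posDef_anticommSuperOp hρ).isUnit
  have inv_mulVec : (anticommSuperOp ρ)⁻¹ *ᵥ X.vec = Z.vec := by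
    rw [← hZ, ← anticommSuperOp_mulVec_vec, mulVec_mulVec, nonsing_inv_mul _ hdet, one_mulVec]
  have trace_eq : (X * Z).trace = 2 * (Z * ρ * Z).trace := by
    rw [← hZ, Matrix.add_mul, trace_add, trace_mul_comm (ρ * Z), ← Matrix.mul_assoc, two_mul]
  rw [quadForm, buresWeight_eq_smul_inv, smul_mulVec, inv_mulVec, dotProduct_smul,
    star_vec_dotProduct_vec, hX.eq, trace_eq, smul_eq_mul, ← mul_assoc]
  norm_num

theorem trace_inv_mul_sub_mul_sub {n 𝕜 : Type*} [Fintype n] [DecidableEq n] [CommRing 𝕜]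
    {R : Matrix n n 𝕜} (hR : IsUnit R.det) (S : Matrix n n 𝕜) :
    (R⁻¹ * ((S - R) * (S - R))).trace = (R⁻¹ * (S * S)).trace - 2 * S.trace + R.trace := by
  have expand : R⁻¹ * ((S - R) * (S - R)) =
      R⁻¹ * (S * S) - R⁻¹ * S * R - R⁻¹ * R * S + R⁻¹ * R * R := by
    noncomm_ring
  rw [expand, nonsing_inv_mul _ hR, Matrix.one_mul, Matrix.one_mul, trace_add, trace_sub,
    trace_sub, trace_mul_comm (R⁻¹ * S), mul_nonsing_inv_cancel_left _ _ hR]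
  ring

theorem sq_buresDist (hρ : IsFullRankState ρ) (hσ : IsState σ) :
    buresDist ρ σ ^ 2 = (ρ⁻¹ * ((opSqrt (opSqrt ρ * σ * opSqrt ρ) - ρ) *
      (opSqrt (opSqrt ρ * σ * opSqrt ρ) - ρ))).trace.re := by
  have hSS := opSqrt_mul_opSqrt (posSemidef_opSqrt_mul_mul_opSqrt hσ.1 ρ)
  have hS := posSemidef_opSqrt (opSqrt ρ * σ * opSqrt ρ)
  rw [buresDist]
  set S := opSqrt (opSqrt ρ * σ * opSqrt ρ)
  have trace_inv_mul : (ρ⁻¹ * (S * S)).trace = 1 := by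
    rw [hSS, ← Matrix.mul_assoc, trace_mul_comm, ← Matrix.mul_assoc, ← Matrix.mul_assoc,
      opSqrt_mul_inv_mul_opSqrt hρ.1, Matrix.one_mul, hσ.2]
  have trace_eq : (ρ⁻¹ * ((S - ρ) * (S - ρ))).trace.re = 2 - 2 * S.trace.re := by
    rw [trace_inv_mul_sub_mul_sub ((isUnit_iff_isUnit_det ρ).mp hρ.1.isUnit), trace_inv_mul, hρ.2,
      sub_add_eq_add_sub, one_add_one_eq_two]
    simp only [Complex.sub_re, Complex.mul_re, Complex.re_ofNat, Complex.im_ofNat, zero_mul,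
      sub_zero]
  have trace_nonneg : 0 ≤ (ρ⁻¹ * ((S - ρ) * (S - ρ))).trace.re := by
    have h := trace_mul_nonneg hρ.1.inv.posSemidef (posSemidef_conjTranspose_mul_self (S - ρ))
    rw [(hS.isHermitian.sub hρ.1.isHermitian).eq] at h
    exact (Complex.nonneg_iff.mp h).1
  rw [trace_eq] at trace_nonneg ⊢
  exact Real.sq_sqrt trace_nonneg

open scoped Matrix.Norms.Frobenius

theorem abs_sq_buresDist_sub_quadForm_le {c : ℝ} (hc : 0 < c)
    (hρc : (ρ - c • (1 : Op d)).PosSemidef) (hρ : IsFullRankState ρ) (hσ : IsState σ) :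
    |buresDist ρ σ ^ 2 - quadForm (buresWeight ρ) (σ - ρ)| ≤
      2 * ‖ρ⁻¹‖ * (‖opSqrt ρ‖ ^ 2 * ‖σ - ρ‖) ^ 3 / c ^ 4 := by
  obtain ⟨Z, hZ⟩ := exists_mul_add_mul_eq hρ.1 (σ - ρ)
  rw [sq_buresDist hρ hσ,
    quadForm_buresWeight hρ.1 (hσ.1.isHermitian.sub hρ.1.isHermitian) hZ]
  have hS := posSemidef_opSqrt (opSqrt ρ * σ * opSqrt ρ)
  have hSS := opSqrt_mul_opSqrt (posSemidef_opSqrt_mul_mul_opSqrt hσ.1 ρ)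
  have hrr := opSqrt_mul_opSqrt hρ.1.posSemidef
  have hrinv := opSqrt_mul_inv_mul_opSqrt hρ.1
  set r := opSqrt ρ
  have trace_eq : (Z * ρ * Z).trace = (ρ⁻¹ * (r * Z * r * (r * Z * r))).trace := by
    calc (Z * ρ * Z).trace = (r * ρ⁻¹ * r * (Z * (r * r) * Z)).trace := by
          rw [hrinv, Matrix.one_mul, hrr]
      _ = (r * (ρ⁻¹ * r * Z * r * r * Z)).trace := by simp only [Matrix.mul_assoc]
      _ = (ρ⁻¹ * (r * Z * r * (r * Z * r))).trace := by
          rw [trace_mul_comm]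
          simp only [Matrix.mul_assoc]
  have perturbed : opSqrt (r * σ * r) * opSqrt (r * σ * r) = ρ * ρ + r * (σ - ρ) * r := by
    rw [hSS, ← hrr]
    noncomm_ring
  have linearized : ρ * (r * Z * r) + r * Z * r * ρ = r * (σ - ρ) * r := by
    rw [← hZ, ← hrr]
    noncomm_ring
  have norm_le : ‖r * (σ - ρ) * r‖ ≤ ‖r‖ ^ 2 * ‖σ - ρ‖ := calc
    ‖r * (σ - ρ) * r‖ ≤ ‖r‖ * ‖σ - ρ‖ * ‖r‖ :=
      (frobenius_norm_mul _ _).trans (by gcongr; exact frobenius_norm_mul _ _)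
    _ = ‖r‖ ^ 2 * ‖σ - ρ‖ := by ring
  rw [trace_eq, ← Complex.sub_re]
  refine ((Complex.abs_re_le_norm _).trans
    (norm_trace_mul_sq_sqrt_sub_sub_trace_mul_sq_le hc hρc hS perturbed linearized ρ⁻¹)).trans ?_
  gcongr

theorem isWeightOf_buresWeight : IsWeightOf buresWeight (buresDist (d := d)) := by
  refine fun ρ hρ => ⟨posSemidef_buresWeight hρ.1, ?_⟩
  obtain ⟨c, hc, hρc⟩ := exists_pos_sub_smul_one_posSemidef hρ.1
  have cubic : (fun σ => buresDist ρ σ ^ 2 - quadForm (buresWeight ρ) (σ - ρ))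
      =O[𝓝[{σ | IsState σ}] ρ] fun σ => ‖σ - ρ‖ ^ 3 := by
    refine .of_bound (2 * ‖ρ⁻¹‖ * (‖opSqrt ρ‖ ^ 2) ^ 3 / c ^ 4) ?_
    filter_upwards [self_mem_nhdsWithin] with σ hσ
    rw [norm_pow, norm_norm]
    refine (abs_sq_buresDist_sub_quadForm_le hc hρc hρ hσ).trans_eq ?_
    ring
  have sq_norm (σ : Op d) : ((σ - ρ)ᴴ * (σ - ρ)).trace.re = ‖σ - ρ‖ ^ 2 := by
    rw [trace_conjTranspose_mul_self_eq_frobenius_norm_sq]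
    rfl
  simp only [sq_norm]
  exact cubic.trans_isLittleO
    ((Asymptotics.isLittleO_pow_sub_pow_sub ρ (by norm_num)).mono nhdsWithin_le_nhds)

end Bures

end QTomo

end

theorem mainTheorem4 {d : ℕ} [NeZero d] {Ω : Type*} [MeasurableSpace Ω]
    (M : QTomo.Measurement d Ω) (hM : M.IsIC) (ρ : QTomo.Op d) (hρ : QTomo.IsFullRankState ρ) :
    -- the covariant measurement is itself one of the measurements in question
    (QTomo.covariant d).IsIC ∧
    -- it minimizes the average WMSE based on any unitarily invariant distance
    (∀ (D : QTomo.Op d → QTomo.Op d → ℝ) (W : QTomo.Op d → QTomo.SuperOp d),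
      QTomo.UnitarilyInvariant D → QTomo.IsWeightOf W D →
      QTomo.OrbitAverageLE ((QTomo.covariant d).wmse W) (M.wmse W) ρ) ∧
    -- the MSE (Hilbert-Schmidt distance)
    (QTomo.UnitarilyInvariant (QTomo.hsDist (d := d)) ∧
      QTomo.IsWeightOf QTomo.hsWeight (QTomo.hsDist (d := d)) ∧
      QTomo.OrbitAverageLE ((QTomo.covariant d).wmse QTomo.hsWeight) (M.wmse QTomo.hsWeight) ρ) ∧
    -- the MSB (Bures distance)
    (QTomo.UnitarilyInvariant (QTomo.buresDist (d := d)) ∧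
      QTomo.IsWeightOf QTomo.buresWeight (QTomo.buresDist (d := d)) ∧
      QTomo.OrbitAverageLE ((QTomo.covariant d).wmse QTomo.buresWeight)
        (M.wmse QTomo.buresWeight) ρ) ∧
    -- the average log-volume of the uncertainty ellipsoid
    QTomo.OrbitAverageLE (fun σ => Real.log ((QTomo.covariant d).volume σ))
      (fun σ => Real.log (M.volume σ)) ρ := by
  have wmse_le {D : QTomo.Op d → QTomo.Op d → ℝ} {W : QTomo.Op d → QTomo.SuperOp d}
      (hD : QTomo.UnitarilyInvariant D) (hW : QTomo.IsWeightOf W D) :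
      QTomo.OrbitAverageLE ((QTomo.covariant d).wmse W) (M.wmse W) ρ :=
    QTomo.orbitAverageLE_wmse hM hρ hD hW
  have hs_invariant := QTomo.unitarilyInvariant_hsDist (d := d)
  have hs_weight := QTomo.isWeightOf_hsWeight (d := d)
  have bures_invariant := QTomo.unitarilyInvariant_buresDist (d := d)
  have bures_weight := QTomo.isWeightOf_buresWeight (d := d)
  exact ⟨QTomo.covariant_isIC, fun _ _ hD hW => wmse_le hD hW,
    ⟨hs_invariant, hs_weight, wmse_le hs_invariant hs_weight⟩,
    ⟨bures_invariant, bures_weight, wmse_le bures_invariant bures_weight⟩,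
    QTomo.orbitAverageLE_log_volume hM hρ⟩
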